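/- **Setting.** Let $p,m,q,n_1,\dots,n_p\ge 1$. Let $f_i:\mathbb R^{n_i}\to\mathbb R\cup\{+\infty\}$ be proper, $h:\mathbb R^q\to\mathbb R$, $A_i\in\mathbb R^{m\times n_i}$, $0\ne B\in\mathbb R^{m\times q}$, $b\in\mathbb R^m$, $\alpha>0$, $\beta\in(0,2)$, $\epsilon_0>1$, and let $Q_i\in\mathbb R^{n_i\times n_i}$, $P\in\mathbb R^{q\times q}$ be symmetric positive semidefinite. Write $\|w\|_M^2=w^TMw$, $\mathbf A\mathbf x=\sum_i A_ix_i$, and $$\mathcal L^\alpha(\mathbf x,y,z)=\sum_{i=1}^p f_i(x_i)+h(y)+\langle z,\mathbf A\mathbf x+By+b\rangle+\tfrac{\alpha}{2}\|\mathbf A\mathbf x+By+b\|^2 .$$ Let $(\mathbf x^k,y^k,z^k)_{k\ge0}$ be generated by the proximal ADMM $$x_i^{k+1}\in\arg\min_{x_i}\ \mathcal L^\alpha(x_{<i}^{k+1},x_i,x_{>i}^k,y^k,z^k)+\tfrac12\|x_i-x_i^k\|_{Q_i}^2\quad(i=1,\dots,p),$$ $$y^{k+1}\in\arg\min_y\ \mathcal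 L^\alpha(\mathbf x^{k+1},y,z^k)+\tfrac12\|y-y^k\|_P^2,\qquad z^{k+1}=z^k+\alpha\beta(\mathbf A\mathbf x^{k+1}+By^{k+1}+b),$$ where the minimal values are finite (the $\arg\min$ of a function that is identically $+\infty$ is empty). **Subdifferential and KŁ exponent.** $\partial\Phi$ is the limiting (Mordukhovich) subdifferential and $\mathrm{dist}(0,\emptyset)=+\infty$. A function $\Phi$ has the KŁ property at $v^*\in\mathrm{dom}\,\partial\Phi$ with exponent $\theta\in[0,1)$ and constant $c>0$ if there are a neighbourhood $U$ of $v^*$ and $\eta>0$ with $(\Phi(v)-\Phi(v^*))^\theta\le c\,\mathrm{dist}(0,\partial\Phi(v))$ for all $v\in U$ such that $\Phi(v^*)<\Phi(v)<\Phi(v^*)+\eta$. **Assumptions.** - A1: each $f_i$ is lower semicontinuous and $f_i(x_i)\to+\infty$ as $\|x_i\|\to\infty$. - A2: $h$ is bounded from below and differentiable, and $\nabla h$ is Lipschitz continuous with constant $L_h$. - A3: $\mathrm{Im}\,\mathbf A\subseteq\mathrm{Im}\,B$ and $b\in\mathrm{Im}\,B$. - A4: for each $i$, either (i) $Q_i\succeq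 q_iI$ for some $q_i>0$, and then $\tau_i:=q_i$; or (ii) there is $\epsilon_i>0$ with $f_i(v)-f_i(w)-\langle s,v-w\rangle\ge-\frac{\epsilon_i}{2}\|v-w\|^2$ for all $v,w$ and all $s\in\partial f_i(w)$, and then $\tau_i:=\lambda_{\min}(\alpha A_i^TA_i-\epsilon_iI)$. If both hold, either value of $\tau_i$ may be used. **Constants.** Let $\lambda_{++}$ be the smallest strictly positive eigenvalue of $B^TB$, let norms of matrices be spectral norms, and put $\rho=1-|1-\beta|$, $c_1=\frac{1}{\alpha\rho\lambda_{++}}$, $c_2=\frac{2\beta}{\alpha\rho^2\lambda_{++}}$, $c_3=c_2\|P\|^2$, $c_4=c_2(\|P\|+L_h)^2$, $c_5=\beta^{-1}|1-\beta|c_1$, $\bar D=2P+\alpha B^TB-L_hI-2\epsilon_0(c_3+c_4)I$, $$\sigma=\min\Big\{\lambda_{\min}(\bar D),\ \min_i\tau_i,\ \tfrac{\epsilon_0-1}{\alpha\beta}\Big\},$$ $$\tilde\rho=\max\Big\{\sum_i\|Q_i\|+\alpha a^2,\ \|P\|+\alpha a\|B\|+4\epsilon_0c_3,\ a+\|B\|+4\epsilon_0c_5\|B\|^2+\tfrac1{\alpha\beta}\Big\},\qquad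 a=\sum_i\|A_i\|,$$ $$\bar{\mathcal L}(\mathbf x,y,z,y',z')=\mathcal L^\alpha(\mathbf x,y,z)+\epsilon_0c_5\|B^T(z-z')\|^2+\epsilon_0c_3\|y-y'\|^2 .$$ **Theorem 2.** Suppose that A1–A4 hold and $\sigma>0$. Let $(\mathbf x^*,y^*,z^*)$ be a limit point of $(\mathbf x^k,y^k,z^k)_{k\ge0}$, put $v^*=(\mathbf x^*,y^*,z^*,y^*,z^*)$, and suppose that $\bar{\mathcal L}$ has the KŁ property at $v^*$ with exponent $\theta\in[0,1)$ and constant $c>0$. Put $\bar{\mathcal L}_k=\bar{\mathcal L}(\mathbf x^k,y^k,z^k,y^{k-1},z^{k-1})$ and $e_k=\bar{\mathcal L}_k-\bar{\mathcal L}(v^*)$ for $k\ge1$, and $\bar\alpha=\dfrac{\sigma}{2(p+2)c^2\tilde\rho^2}$. Then $\bar{\mathcal L}_k$ is finite and $e_k\ge0$ for all $k\ge1$, $e_k\to0$, and: - (i) if $\theta=0$, then $e_k=0$ for all sufficiently large $k$; - (ii) if $\theta\in(0,1/2]$, then for all sufficiently large $k_0$ and all $k\ge k_0$, $$e_k\le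 \frac{e_{k_0}}{\big(1+\bar\alpha\,e_{k_0}^{2\theta-1}\big)^{k-k_0}};$$ - (iii) if $\theta\in(1/2,1)$, then there is $\mu>0$ such that for all sufficiently large $k_0$ and all $k\ge k_0$, $$e_k\le\big(\mu(k-k_0)+\mu+e_{k_0-1}^{1-2\theta}\big)^{\frac1{1-2\theta}},$$ in particular $e_k=O(k^{-1/(2\theta-1)})$. (If $e_{k_0}=0$ in (ii), or $e_{k_0-1}=0$ in (iii), then $e_k=0$ for all $k\ge k_0$, and the bound is read as trivially true.) -/

import Mathlib

open Filter Topology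
open scoped InnerProductSpace

noncomputable section

namespace PADMM

/-! Variational analysis for extended-real-valued functions.
Functions into `ℝ ∪ {+∞}` are functions into `EReal` that never take the value `⊥`. -/

section Variational

variable {E : Type*} [NormedAddCommGroup E] [InnerProductSpace ℝ E]

/-- `Φ : E → ℝ ∪ {+∞}` and `Φ` is not identically `+∞`. -/
def IsProper (Φ : E → EReal) : Prop :=
  (∀ x, Φ x ≠ ⊥) ∧ ∃ x, Φ x ≠ ⊤

/-- `a` belongs to `argmin g`; as usual `argmin g` is empty when `g` is identically `+∞`. -/
def IsArgmin (g : E → EReal) (a : E) : Prop :=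
  g a < ⊤ ∧ ∀ w, g a ≤ g w

/-- Fréchet subdifferential:
`liminf_{y → x, y ≠ x} (Φ y - Φ x - ⟪s, y - x⟫) / ‖y - x‖ ≥ 0`, for `x` in the domain. -/
def frechetSubdiff (Φ : E → EReal) (x : E) : Set E :=
  {s | Φ x ≠ ⊤ ∧ ∀ ε : ℝ, 0 < ε → ∀ᶠ y in 𝓝 x,
    Φ x + ((⟪s, y - x⟫_ℝ - ε * ‖y - x‖ : ℝ) : EReal) ≤ Φ y}

/-- Limiting (Mordukhovich) subdifferential. -/
def limSubdiff (Φ : E → EReal) (x : E) : Set E :=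
  {s | Φ x ≠ ⊤ ∧ ∃ (u : ℕ → E) (t : ℕ → E),
    Tendsto u atTop (𝓝 x) ∧ Tendsto (fun k => Φ (u k)) atTop (𝓝 (Φ x)) ∧
    (∀ k, t k ∈ frechetSubdiff Φ (u k)) ∧ Tendsto t atTop (𝓝 s)}

/-- `f v - f w - ⟪s, v - w⟫ ≥ -(ε / 2) ‖v - w‖²` for all `v`, `w` and all `s ∈ ∂f(w)`. -/
def WeaklyConvex (f : E → EReal) (ε : ℝ) : Prop :=
  ∀ v w, ∀ s ∈ limSubdiff f w,
    f w + ((⟪s, v - w⟫_ℝ - ε / 2 * ‖v - w‖ ^ 2 : ℝ) : EReal) ≤ f v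

/-- `Φ` has the Kurdyka–Łojasiewicz property at `a ∈ dom ∂Φ` with exponent `θ ∈ [0, 1)` and
constant `c > 0`: `(Φ v - Φ a) ^ θ ≤ c * dist (0, ∂Φ(v))` for all `v` in a neighbourhood of `a`
with `Φ a < Φ v < Φ a + η`. The distance to the empty set is `+∞`. -/
def HasKLExponent (Φ : E → EReal) (a : E) (θ c : ℝ) : Prop :=
  0 ≤ θ ∧ θ < 1 ∧ 0 < c ∧ (limSubdiff Φ a).Nonempty ∧
    ∃ U ∈ 𝓝 a, ∃ η : ℝ, 0 < η ∧ ∀ v ∈ U, Φ a < Φ v → Φ v < Φ a + (η : EReal) →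
      ENNReal.ofReal (((Φ v).toReal - (Φ a).toReal) ^ θ) ≤
        ENNReal.ofReal c * Metric.infEDist 0 (limSubdiff Φ v)

end Variational

/-- `ℝ^d` with the Euclidean norm. An `r × s` real matrix is used as the linear map
`ℝ^s → ℝ^r` that it represents; its norm is the spectral norm and its transpose the adjoint. -/
abbrev Vec (d : ℕ) := EuclideanSpace ℝ (Fin d)

/-- The smallest eigenvalue of a symmetric matrix. -/
def lamMin {d : ℕ} (M : Vec d →L[ℝ] Vec d) : ℝ :=
  sInf {μ : ℝ | Module.End.HasEigenvalue (M : Vec d →ₗ[ℝ] Vec d) μ}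

/-- The smallest strictly positive eigenvalue of a symmetric matrix. -/
def lamPos {d : ℕ} (M : Vec d →L[ℝ] Vec d) : ℝ :=
  sInf {μ : ℝ | 0 < μ ∧ Module.End.HasEigenvalue (M : Vec d →ₗ[ℝ] Vec d) μ}

/-- The quadratic form `‖w‖²_M = wᵀ M w`. -/
def qform {d : ℕ} (M : Vec d →L[ℝ] Vec d) (w : Vec d) : ℝ := ⟪w, M w⟫_ℝ

/-- The space `ℝ^n × ℝ^q × ℝ^m × ℝ^q × ℝ^m` of points `(x, y, z, y', z')`, with its Euclidean
norm, where `ℝ^n = ℝ^{n_1} × ⋯ × ℝ^{n_p}`. -/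
abbrev LyapSpace {p : ℕ} (n : Fin p → ℕ) (q m : ℕ) :=
  WithLp 2 (PiLp 2 (fun i => Vec (n i)) ×
    WithLp 2 (Vec q × WithLp 2 (Vec m × WithLp 2 (Vec q × Vec m))))

/-- The point `(x, y, z, y', z')`. -/
def lyapPoint {p : ℕ} {n : Fin p → ℕ} {q m : ℕ} (x : ∀ i, Vec (n i)) (y : Vec q) (z : Vec m)
    (y' : Vec q) (z' : Vec m) : LyapSpace n q m :=
  WithLp.toLp 2 (WithLp.toLp 2 x,
    WithLp.toLp 2 (y, WithLp.toLp 2 (z, WithLp.toLp 2 (y', z'))))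

/-- The data of the problem `min ∑ᵢ fᵢ(xᵢ) + h(y)` subject to `∑ᵢ Aᵢ xᵢ + B y + b = 0`, the
parameters `α`, `β`, `Qᵢ`, `P` of the algorithm, the Lipschitz constant `Lh` of `∇h`, and the
parameter `ε₀` of the Lyapunov function. -/
structure Data (p : ℕ) (n : Fin p → ℕ) (q m : ℕ) where
  f : ∀ i, Vec (n i) → EReal
  h : Vec q → ℝ
  A : ∀ i, Vec (n i) →L[ℝ] Vec m
  B : Vec q →L[ℝ] Vec m
  b : Vec m
  α : ℝ
  β : ℝ
  Q : ∀ i, Vec (n i) →L[ℝ] Vec (n i)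
  P : Vec q →L[ℝ] Vec q
  Lh : ℝ
  ε₀ : ℝ

namespace Data

variable {p : ℕ} {n : Fin p → ℕ} {q m : ℕ} (S : Data p n q m)

/-- The standing conditions on the data. -/
structure Standing : Prop where
  proper : ∀ i, IsProper (S.f i)
  B_ne_zero : S.B ≠ 0
  α_pos : 0 < S.α
  β_pos : 0 < S.β
  β_lt_two : S.β < 2
  Q_psd : ∀ i, (S.Q i).IsPositive
  P_psd : S.P.IsPositive
  one_lt_ε₀ : 1 < S.ε₀

/-- Each `fᵢ` is lower semicontinuous and coercive. -/
def A1 : Prop :=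
  ∀ i, LowerSemicontinuous (S.f i) ∧
    Tendsto (S.f i) (Bornology.cobounded (Vec (n i))) (𝓝 ⊤)

/-- `h` is bounded from below and differentiable with `Lh`-Lipschitz gradient. -/
def A2 : Prop :=
  BddBelow (Set.range S.h) ∧ Differentiable ℝ S.h ∧
    ∀ u v, ‖gradient S.h v - gradient S.h u‖ ≤ S.Lh * ‖v - u‖

/-- `Im 𝐀 ⊆ Im B` and `b ∈ Im B`, where `𝐀 x = ∑ᵢ Aᵢ xᵢ`. -/
def A3 : Prop :=
  (∀ x : ∀ i, Vec (n i), ∑ i, S.A i (x i) ∈ Set.range S.B) ∧ S.b ∈ Set.range S.B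

/-- The alternative for each block, together with the modulus `τ i` that it provides: either
`Qᵢ ⪰ qᵢ I` with `qᵢ > 0`, and `τ i = qᵢ`; or `fᵢ` is weakly convex with constant `εᵢ > 0`, and
`τ i = λ_min(α Aᵢᵀ Aᵢ - εᵢ I)`. If both hold, either (hence the larger) value may be used. -/
def A4 (τ : Fin p → ℝ) : Prop :=
  ∀ i, (∃ qi : ℝ, 0 < qi ∧ (∀ w, qi * ‖w‖ ^ 2 ≤ qform (S.Q i) w) ∧ τ i = qi) ∨
    (∃ ε : ℝ, 0 < ε ∧ WeaklyConvex (S.f i) ε ∧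
      τ i = lamMin (S.α • ((S.A i).adjoint ∘L S.A i) - ε • ContinuousLinearMap.id ℝ (Vec (n i))))

/-- `𝐀 x + B y + b`. -/
def residual (x : ∀ i, Vec (n i)) (y : Vec q) : Vec m :=
  ∑ i, S.A i (x i) + S.B y + S.b

/-- The augmented Lagrangian. -/
def augLag (x : ∀ i, Vec (n i)) (y : Vec q) (z : Vec m) : EReal :=
  ∑ i, S.f i (x i) +
    ((S.h y + ⟪z, S.residual x y⟫_ℝ + S.α / 2 * ‖S.residual x y‖ ^ 2 : ℝ) : EReal)

/-- The sequence `(x k, y k, z k)`, `k ≥ 0`, is generated by the proximal ADMM. In the `i`-th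
block update the blocks `j < i` are new and the blocks `j > i` are old. -/
structure IsGenerated (x : ℕ → ∀ i, Vec (n i)) (y : ℕ → Vec q) (z : ℕ → Vec m) : Prop where
  x_step : ∀ k i, IsArgmin
    (fun w : Vec (n i) =>
      S.augLag (Function.update (fun j => if j < i then x (k + 1) j else x k j) i w) (y k) (z k)
        + ((1 / 2 * qform (S.Q i) (w - x k i) : ℝ) : EReal))
    (x (k + 1) i)
  y_step : ∀ k, IsArgmin
    (fun w : Vec q =>
      S.augLag (x (k + 1)) w (z k) + ((1 / 2 * qform S.P (w - y k) : ℝ) : EReal))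
    (y (k + 1))
  z_step : ∀ k, z (k + 1) = z k + (S.α * S.β) • S.residual (x (k + 1)) (y (k + 1))

/-- `ρ(β) = 1 - |1 - β|`. -/
def rho : ℝ := 1 - |1 - S.β|

/-- The smallest strictly positive eigenvalue of `Bᵀ B`. -/
def lamB : ℝ := lamPos (S.B.adjoint ∘L S.B)

def c1 : ℝ := 1 / (S.α * S.rho * S.lamB)

def c2 : ℝ := 2 * S.β / (S.α * S.rho ^ 2 * S.lamB)

def c3 : ℝ := S.c2 * ‖S.P‖ ^ 2

def c4 : ℝ := S.c2 * (‖S.P‖ + S.Lh) ^ 2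

def c5 : ℝ := S.β⁻¹ * |1 - S.β| * S.c1

/-- `D = 2 P + α Bᵀ B - L_h I`. -/
def matD : Vec q →L[ℝ] Vec q :=
  (2 : ℝ) • S.P + S.α • (S.B.adjoint ∘L S.B) - S.Lh • ContinuousLinearMap.id ℝ (Vec q)

/-- `D̄ = D - 2 ε₀ (c₃ + c₄) I`. -/
def matDbar : Vec q →L[ℝ] Vec q :=
  S.matD - (2 * S.ε₀ * (S.c3 + S.c4)) • ContinuousLinearMap.id ℝ (Vec q)

/-- `σ = min {λ_min(D̄), minᵢ τ i, (ε₀ - 1) / (α β)}`. -/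
def sigma (τ : Fin p → ℝ) : ℝ :=
  min (lamMin S.matDbar) (min (⨅ i, τ i) ((S.ε₀ - 1) / (S.α * S.β)))

/-- The constant `ρ̃`. -/
def rhoTilde : ℝ :=
  max ((∑ i, ‖S.Q i‖) + S.α * (∑ i, ‖S.A i‖) ^ 2)
    (max (‖S.P‖ + S.α * (∑ i, ‖S.A i‖) * ‖S.B‖ + 4 * S.ε₀ * S.c3)
      ((∑ i, ‖S.A i‖) + ‖S.B‖ + 4 * S.ε₀ * S.c5 * ‖S.B‖ ^ 2 + 1 / (S.α * S.β)))

/-- The constant `ᾱ`, for the constant `c` of the KŁ inequality. -/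
def alphaBar (τ : Fin p → ℝ) (c : ℝ) : ℝ :=
  S.sigma τ / (2 * ((p : ℝ) + 2) * c ^ 2 * S.rhoTilde ^ 2)

/-- The Lyapunov function
`L̄(x, y, z, y', z') = L^α(x, y, z) + ε₀ c₅ ‖Bᵀ(z - z')‖² + ε₀ c₃ ‖y - y'‖²`. -/
def Lbar (v : LyapSpace n q m) : EReal :=
  let x : ∀ i, Vec (n i) := fun i => v.fst i
  let y : Vec q := v.snd.fst
  let z : Vec m := v.snd.snd.fst
  let y' : Vec q := v.snd.snd.snd.fst
  let z' : Vec m := v.snd.snd.snd.snd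
  S.augLag x y z +
    ((S.ε₀ * S.c5 * ‖S.B.adjoint (z - z')‖ ^ 2 + S.ε₀ * S.c3 * ‖y - y'‖ ^ 2 : ℝ) : EReal)

/-- `L̄_k = L̄(x^k, y^k, z^k, y^{k-1}, z^{k-1})`, for `k ≥ 1`. -/
def LbarSeq (x : ℕ → ∀ i, Vec (n i)) (y : ℕ → Vec q) (z : ℕ → Vec m) (k : ℕ) : EReal :=
  S.Lbar (lyapPoint (x k) (y k) (z k) (y (k - 1)) (z (k - 1)))

/-- `e_k = L̄_k - L̄(v)`, for `k ≥ 1`. -/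
def gap (x : ℕ → ∀ i, Vec (n i)) (y : ℕ → Vec q) (z : ℕ → Vec m) (v : LyapSpace n q m)
    (k : ℕ) : ℝ :=
  (S.LbarSeq x y z k).toReal - (S.Lbar v).toReal

end Data

/-- `(xs, ys, zs)` is a limit point of the sequence `(x k, y k, z k)`. -/
def IsLimitPoint {p : ℕ} {n : Fin p → ℕ} {q m : ℕ} (x : ℕ → ∀ i, Vec (n i)) (y : ℕ → Vec q)
    (z : ℕ → Vec m) (xs : ∀ i, Vec (n i)) (ys : Vec q) (zs : Vec m) : Prop :=
  ∃ φ : ℕ → ℕ, StrictMono φ ∧ Tendsto (fun j => x (φ j)) atTop (𝓝 xs) ∧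
    Tendsto (fun j => y (φ j)) atTop (𝓝 ys) ∧ Tendsto (fun j => z (φ j)) atTop (𝓝 zs)

end PADMM

end

/-! The proof is the descent scheme of Kurdyka–Łojasiewicz theory, made quantitative and run from a
limit point without assuming that the iterates are bounded.

Sufficient decrease (`lyapVal_decrease`). The block updates and the `y`-update lower the augmented
Lagrangian, while the multiplier update raises it by `‖Δz‖² / (αβ)`. Optimality in `y` turns the
multiplier update into a relaxed recursion for `Bᵀz`, driven by `∇h` and `P Δy`. Since `Δz` lies in
`Im B`, where `Bᵀ` is bounded below by `√λ₊₊`, the increase is paid for by `Δy` terms and a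
telescoping difference of `‖BᵀΔz‖²` (`dual_step_norm_sq_le`). The two terms added in `Lbar` absorb
the delayed quantities, and `ε₀ > 1` leaves a surplus in `‖Δz‖²`.

Relative error (`exists_subgradient_le_stepSq`). Each argmin gives a global quadratic minorant of
`fᵢ`. Adding these to a quadratic minorant of the smooth part yields a proximal subgradient of
`Lbar` directly, with no sum rule; after cancellation by the optimality conditions its norm is at
most a multiple of the step length.

Values (`tendsto_lyapVal`). Lower semicontinuity at the limit point bounds the decreasing values
from below, so steps vanish. Testing each argmin against the limit point then gives convergence of
the `fᵢ` values along the subsequence, hence `e → 0`.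

Trapping (`exists_forall_ge_kl`). Once an iterate is close to the limit point with a small gap and a
small step, the remaining path is too short to leave the neighbourhood, so the Kurdyka–Łojasiewicz
inequality holds at all later iterates. Squaring it and inserting the decrease gives `ᾱ e_{k+1}^{2θ}
≤ e_k - e_{k+1}` whenever `e_{k+1} > 0`; the three rates follow from this scalar recursion. -/

namespace PADMM

/-! ### Rates of convergence from a recursive inequality -/

section Rates

theorem rpow_one_sub_tangent {s t θ : ℝ} (hs : 0 ≤ s) (ht : 0 < t) (h0 : 0 ≤ θ) (h1 : θ < 1) :
    (1 - θ) * t ^ (-θ) * (t - s) ≤ t ^ (1 - θ) - s ^ (1 - θ) := by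
  have hst : -1 ≤ s / t - 1 := by have : 0 ≤ s / t := by positivity
                                  linarith
  have h := rpow_one_add_le_one_add_mul_self hst (p := 1 - θ) (by linarith) (by linarith)
  rw [add_sub_cancel, Real.div_rpow hs ht.le, div_le_iff₀ (by positivity)] at h
  have e : t ^ (1 - θ) = t ^ (-θ) * t := by
    rw [← Real.rpow_add_one ht.ne']; ring_nf
  have e2 : (1 + (1 - θ) * (s / t - 1)) * t ^ (1 - θ)
      = t ^ (1 - θ) - (1 - θ) * t ^ (-θ) * (t - s) := by
    rw [e]; field_simp; ring
  linarith

/-- The tangent inequality for the convex function `t ↦ t ^ (-ν)`. -/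
theorem rpow_neg_tangent {s t ν : ℝ} (hs : 0 < s) (ht : 0 < t) (hν : 0 ≤ ν) :
    t ^ (-ν) * (1 + ν * (1 - s / t)) ≤ s ^ (-ν) := by
  have h1 : 1 - s / t ≤ Real.log (t / s) := by
    have := Real.one_sub_inv_le_log_of_pos (div_pos ht hs)
    rwa [inv_div] at this
  have h2 : 1 + ν * (1 - s / t) ≤ (t / s) ^ ν := by
    rw [Real.rpow_def_of_pos (div_pos ht hs)]
    have := Real.add_one_le_exp (Real.log (t / s) * ν)
    nlinarith
  have h3 : s ^ (-ν) = t ^ (-ν) * (t / s) ^ ν := by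
    rw [Real.div_rpow ht.le hs.le, Real.rpow_neg hs.le, Real.rpow_neg ht.le]
    have := Real.rpow_pos_of_pos hs ν
    have := Real.rpow_pos_of_pos ht ν
    field_simp
  rw [h3]
  exact mul_le_mul_of_nonneg_left h2 (Real.rpow_nonneg ht.le _)

variable {e : ℕ → ℝ} {θ γ : ℝ} {K : ℕ}

theorem eventually_eq_zero_of_recursive (he : Tendsto e atTop (𝓝 0)) (h0 : ∀ k ≥ K, 0 ≤ e k)
    (hγ : 0 < γ) (hrec : ∀ k ≥ K, 0 < e (k + 1) → γ ≤ e k - e (k + 1)) :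
    ∃ N : ℕ, ∀ k : ℕ, N ≤ k → e k = 0 := by
  obtain ⟨N, hN⟩ := eventually_atTop.1 (he.eventually (gt_mem_nhds hγ))
  refine ⟨max N K + 1, fun k hk => ?_⟩
  obtain ⟨j, rfl⟩ : ∃ j, k = j + 1 := ⟨k - 1, by omega⟩
  by_contra hne
  have h1 := h0 (j + 1) (by omega)
  have h2 := hrec j (by omega) (lt_of_le_of_ne h1 (Ne.symm hne))
  have h3 := hN j (by omega)
  linarith

/-- As `2θ - 1 ≤ 0` and `e` decreases, `e_{k+1}^{2θ-1}` is at least its value at `k₀`. Splitting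
`e^{2θ} = e^{2θ-1} · e` makes the recursion a contraction with a fixed factor. -/
theorem linear_rate_of_recursive (h0 : ∀ k ≥ K, 0 ≤ e k) (hanti : ∀ k ≥ K, e (k + 1) ≤ e k)
    (hθ : θ ≤ 1 / 2) (hγ : 0 < γ)
    (hrec : ∀ k ≥ K, 0 < e (k + 1) → γ * e (k + 1) ^ (2 * θ) ≤ e k - e (k + 1))
    {k₀ : ℕ} (hk₀ : K ≤ k₀) {k : ℕ} (hk : k₀ ≤ k) :
    e k ≤ e k₀ / (1 + γ * e k₀ ^ (2 * θ - 1)) ^ (k - k₀) := by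
  have hq : 0 < 1 + γ * e k₀ ^ (2 * θ - 1) := by
    have := Real.rpow_nonneg (h0 k₀ hk₀) (2 * θ - 1)
    positivity
  suffices H : ∀ j : ℕ, e (k₀ + j) ≤ e k₀ ∧
      e (k₀ + j) ≤ e k₀ / (1 + γ * e k₀ ^ (2 * θ - 1)) ^ j by
    obtain ⟨j, rfl⟩ := Nat.exists_eq_add_of_le hk
    simpa using (H j).2
  intro j
  induction j with
  | zero => simp
  | succ j ih =>
    have hle : e (k₀ + (j + 1)) ≤ e k₀ := (hanti (k₀ + j) (by omega)).trans ih.1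
    refine ⟨hle, ?_⟩
    rcases (h0 (k₀ + (j + 1)) (by omega)).eq_or_lt with h | h
    · rw [← h]; have := h0 k₀ hk₀; positivity
    have h1 := hrec (k₀ + j) (by omega) h
    have h2 : e k₀ ^ (2 * θ - 1) ≤ e (k₀ + (j + 1)) ^ (2 * θ - 1) :=
      Real.rpow_le_rpow_of_nonpos h hle (by linarith)
    have h3 : e (k₀ + (j + 1)) ^ (2 * θ)
        = e (k₀ + (j + 1)) ^ (2 * θ - 1) * e (k₀ + (j + 1)) := by
      rw [← Real.rpow_add_one h.ne']; ring_nf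
    have h4 : e (k₀ + (j + 1)) * (1 + γ * e k₀ ^ (2 * θ - 1)) ≤ e (k₀ + j) := by
      rw [← add_assoc] at h h2 h3 ⊢
      rw [h3] at h1
      nlinarith [mul_le_mul_of_nonneg_left h2 (mul_nonneg hγ.le h.le)]
    rw [pow_succ, ← div_div, le_div_iff₀ hq]
    exact h4.trans ih.2

/-- In the variable `e^{1-2θ}` the recursion becomes growth by a fixed amount per step. If `s ≥ t /
2`, the tangent of `t ↦ t^{-ν}` gives the increment; if `s < t / 2`, the power alone grows by the
factor `2^ν`, and `t ≤ 1` makes this an additive gain. -/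
theorem exists_rpow_increment (hθ : 1 / 2 < θ) (hγ : 0 < γ) :
    ∃ μ : ℝ, 0 < μ ∧ ∀ s t : ℝ, 0 < s → s ≤ t → t ≤ 1 → γ * s ^ (2 * θ) ≤ t - s →
      t ^ (1 - 2 * θ) + μ ≤ s ^ (1 - 2 * θ) := by
  set ν := 2 * θ - 1 with hν
  have hν0 : 0 < ν := by linarith
  have h2ν : 1 < (2 : ℝ) ^ ν := Real.one_lt_rpow (by norm_num) hν0
  refine ⟨min (ν * γ * (1 / 2) ^ (2 * θ)) (2 ^ ν - 1), lt_min (by positivity) (by linarith), ?_⟩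
  intro s t hs hst ht1 hrec
  have ht : 0 < t := hs.trans_le hst
  have e1 : 1 - 2 * θ = -ν := by rw [hν]; ring
  rw [e1]
  rcases le_or_gt t (2 * s) with h | h
  · have h1 := rpow_neg_tangent hs ht hν0.le
    have h2 : γ * (1 / 2) ^ (2 * θ) ≤ t ^ (-ν) * (1 - s / t) := by
      have a1 : t ^ (-ν) * (1 - s / t) = (t - s) / t ^ (2 * θ) := by
        have : (2 * θ) = ν + 1 := by rw [hν]; ring
        rw [this, Real.rpow_add_one ht.ne', Real.rpow_neg ht.le]
        have := Real.rpow_pos_of_pos ht ν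
        field_simp
      rw [a1, le_div_iff₀ (by positivity), mul_assoc, ← Real.mul_rpow (by norm_num) ht.le]
      refine le_trans ?_ hrec
      gcongr
      linarith
    have h3 := mul_le_mul_of_nonneg_left h2 hν0.le
    have h4 := min_le_left (ν * γ * (1 / 2) ^ (2 * θ)) ((2 : ℝ) ^ ν - 1)
    nlinarith
  · have h1 : t ^ (-ν) * 2 ^ ν ≤ s ^ (-ν) := by
      have : (t / 2) ^ (-ν) ≤ s ^ (-ν) :=
        Real.rpow_le_rpow_of_nonpos hs (by linarith) (by linarith)
      rwa [Real.div_rpow ht.le (by norm_num), Real.rpow_neg (by norm_num : (0:ℝ) ≤ 2), div_inv_eq_mul]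
        at this
    have h2 : 1 ≤ t ^ (-ν) := Real.one_le_rpow_of_pos_of_le_one_of_nonpos ht ht1 (by linarith)
    have h4 := min_le_right (ν * γ * (1 / 2) ^ (2 * θ)) ((2 : ℝ) ^ ν - 1)
    nlinarith

theorem sublinear_rate_of_recursive (he : Tendsto e atTop (𝓝 0)) (h0 : ∀ k ≥ K, 0 ≤ e k)
    (hanti : ∀ k ≥ K, e (k + 1) ≤ e k) (hθ : 1 / 2 < θ) (hγ : 0 < γ)
    (hrec : ∀ k ≥ K, 0 < e (k + 1) → γ * e (k + 1) ^ (2 * θ) ≤ e k - e (k + 1)) :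
    ∃ μ : ℝ, 0 < μ ∧ ∃ N : ℕ, 2 ≤ N ∧ ∀ k₀ : ℕ, N ≤ k₀ → ∀ k : ℕ, k₀ ≤ k →
      e k ≤ (μ * ((k : ℝ) - (k₀ : ℝ)) + μ + e (k₀ - 1) ^ (1 - 2 * θ)) ^ (1 / (1 - 2 * θ)) := by
  obtain ⟨μ, hμ, hinc⟩ := exists_rpow_increment (γ := γ) hθ hγ
  obtain ⟨N, hN⟩ := eventually_atTop.1 (he.eventually (gt_mem_nhds one_pos))
  refine ⟨μ, hμ, max N K + 2, by omega, fun k₀ hk₀ k hk => ?_⟩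
  have key : ∀ j : ℕ, 0 < e (k₀ - 1 + j) →
      μ * j + e (k₀ - 1) ^ (1 - 2 * θ) ≤ e (k₀ - 1 + j) ^ (1 - 2 * θ) := by
    intro j
    induction j with
    | zero => simp
    | succ j ih =>
      intro hpos
      have hle := hanti (k₀ - 1 + j) (by omega)
      have h1 := ih (hpos.trans_le hle)
      have h2 := hinc _ _ hpos hle (hN (k₀ - 1 + j) (by omega)).le (hrec (k₀ - 1 + j) (by omega) hpos)
      push_cast
      rw [← add_assoc] at h2 ⊢
      linarith
  have hk0' : 0 ≤ e (k₀ - 1) := h0 _ (by omega)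
  have hkk : (0 : ℝ) ≤ (k : ℝ) - k₀ := by
    have : (k₀ : ℝ) ≤ k := by exact_mod_cast hk
    linarith
  have hbase : 0 < μ * ((k : ℝ) - (k₀ : ℝ)) + μ + e (k₀ - 1) ^ (1 - 2 * θ) := by positivity
  rcases (h0 k (by omega)).eq_or_lt with h | h
  · rw [← h]; positivity
  -- The count starts at `k₀ - 1`, so there are `k - k₀ + 1` increments; this is the source of the
  -- extra `μ`.
  obtain ⟨j, rfl⟩ : ∃ j, k = k₀ - 1 + j := ⟨k + 1 - k₀, by omega⟩
  have h1 := key j h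
  have hj : (j : ℝ) = ((k₀ - 1 + j : ℕ) : ℝ) - k₀ + 1 := by
    have : k₀ - 1 + j + 1 = k₀ + j := by omega
    have : ((k₀ - 1 + j : ℕ) : ℝ) + 1 = k₀ + j := by exact_mod_cast this
    linarith
  have h2 : μ * (((k₀ - 1 + j : ℕ) : ℝ) - (k₀ : ℝ)) + μ + e (k₀ - 1) ^ (1 - 2 * θ)
      ≤ e (k₀ - 1 + j) ^ (1 - 2 * θ) := by
    refine le_trans (le_of_eq ?_) h1
    rw [hj]; push_cast; ring
  have h3 := Real.rpow_le_rpow_of_nonpos hbase h2 (z := 1 / (1 - 2 * θ))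
    (by apply div_nonpos_of_nonneg_of_nonpos <;> linarith)
  rwa [← Real.rpow_mul h.le, mul_one_div_cancel (by linarith), Real.rpow_one] at h3

end Rates

/-! ### Finite length of a descent sequence near a Kurdyka–Łojasiewicz point -/

/-- Concavity of `t ↦ t^{1-θ}` converts the decrease `t - s` into a decrease of `t^{1-θ}` at the
price of the factor `t^θ`, which the Kurdyka–Łojasiewicz bound replaces by `C d`. Thus `d'² ≤ d X`,
and the arithmetic-geometric mean inequality separates the product. -/
theorem two_mul_le_of_desingularization {a C θ d d' s t : ℝ} (ha : 0 < a) (hC : 0 < C)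
    (h0 : 0 ≤ θ) (h1 : θ < 1) (hs : 0 < s) (ht : 0 < t) (hd : 0 ≤ d)
    (hdec : a * d' ^ 2 ≤ t - s) (hkl : t ^ θ ≤ C * d) :
    2 * d' ≤ d + C / ((1 - θ) * a) * (t ^ (1 - θ) - s ^ (1 - θ)) := by
  have hθ : 0 < 1 - θ := by linarith
  have htθ : 0 < t ^ θ := by positivity
  have htan := rpow_one_sub_tangent hs.le ht h0 h1
  set X := C / ((1 - θ) * a) * (t ^ (1 - θ) - s ^ (1 - θ)) with hX
  have hts : 0 ≤ t - s := le_trans (by positivity) hdec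
  have hXd : d' ^ 2 ≤ d * X := by
    have e1 : d * X = (C * d) * ((t ^ (1 - θ) - s ^ (1 - θ)) / ((1 - θ) * a)) := by
      rw [hX]; ring
    have e2 : t ^ θ * (((1 - θ) * t ^ (-θ) * (t - s)) / ((1 - θ) * a)) = (t - s) / a := by
      rw [Real.rpow_neg ht.le]; field_simp
    have h5 : 0 ≤ (1 - θ) * t ^ (-θ) * (t - s) := by positivity
    calc d' ^ 2 ≤ (t - s) / a := by rw [le_div_iff₀ ha]; linarith
      _ = t ^ θ * (((1 - θ) * t ^ (-θ) * (t - s)) / ((1 - θ) * a)) := e2.symm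
      _ ≤ (C * d) * ((t ^ (1 - θ) - s ^ (1 - θ)) / ((1 - θ) * a)) := by gcongr
      _ = d * X := e1.symm
  have hX0 : 0 ≤ X := by
    have : 0 ≤ (1 - θ) * t ^ (-θ) * (t - s) := by positivity
    have : 0 ≤ t ^ (1 - θ) - s ^ (1 - θ) := this.trans htan
    positivity
  have : (2 * d') ^ 2 ≤ (d + X) ^ 2 := by nlinarith [sq_nonneg (d - X)]
  exact le_of_sq_le_sq this (by positivity)

/-- The inequality `hkl` is available only near `ws`, at two consecutive points because the Lyapunov
function also sees the previous iterate. One induction proves the length bound: the bound up to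
index `i` keeps the iterates in the ball, so `hkl` applies at `i` and extends the bound to `i + 1`.
-/
theorem exists_forall_ge_kl {W : Type*} [PseudoMetricSpace W] {w : ℕ → W} {ws : W}
    {d e : ℕ → ℝ} {a C r η θ : ℝ} {φ : ℕ → ℕ} (ha : 0 < a) (hC : 0 < C) (hr : 0 < r) (hη : 0 < η)
    (h0 : 0 ≤ θ) (h1 : θ < 1) (hd : ∀ k, 0 ≤ d k)
    (hwd : ∀ k, dist (w (k + 1)) (w k) ≤ d (k + 1))
    (hdec : ∀ k, 1 ≤ k → a * d (k + 1) ^ 2 ≤ e k - e (k + 1)) (hpos : ∀ k, 1 ≤ k → 0 < e k)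
    (he : Tendsto e atTop (𝓝 0)) (hd0 : Tendsto d atTop (𝓝 0))
    (hφ : StrictMono φ) (hw : Tendsto (fun j => w (φ j)) atTop (𝓝 ws))
    (hkl : ∀ k, 1 ≤ k → dist (w k) ws < r → dist (w (k - 1)) ws < r → e k < η →
      e k ^ θ ≤ C * d k) :
    ∃ K, 1 ≤ K ∧ ∀ k, K ≤ k → e k ^ θ ≤ C * d k := by
  have hθ : 0 < 1 - θ := by linarith
  set M := C / ((1 - θ) * a) with hM
  have hM0 : 0 < M := by positivity
  have hψ : Tendsto (fun k => M * e k ^ (1 - θ)) atTop (𝓝 0) := by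
    have := (he.rpow_const (p := 1 - θ) (Or.inr hθ.le)).const_mul M
    simpa [Real.zero_rpow hθ.ne'] using this
  have hr4 : 0 < r / 4 := by linarith
  obtain ⟨N, hN⟩ := eventually_atTop.1 (he.eventually (gt_mem_nhds hη))
  have hφt := hφ.tendsto_atTop
  -- The start is an index of the subsequence at which the distance to `ws`, the last step and the
  -- desingularized gap are each below `r / 4`.
  obtain ⟨j, hj1, hj2, hj3, hj4⟩ :=
    ((hφt.eventually (eventually_ge_atTop (max N 1))).and
      ((Metric.tendsto_nhds.1 hw _ hr4).and
        ((hφt.eventually (hd0.eventually (gt_mem_nhds hr4))).and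
          (hφt.eventually (hψ.eventually (gt_mem_nhds hr4)))))).exists
  set K := φ j
  have hK1 : 1 ≤ K := le_trans (le_max_right _ _) hj1
  have hKN : N ≤ K := le_trans (le_max_left _ _) hj1
  have hdist : ∀ i, dist (w (K + i)) (w K) ≤ ∑ l ∈ Finset.range i, d (K + l + 1) := by
    intro i
    induction i with
    | zero => simp
    | succ i ih =>
      rw [Finset.sum_range_succ]
      exact (dist_triangle _ (w (K + i)) _).trans (by have := hwd (K + i); rw [← add_assoc]; linarith)
  have near : ∀ i, ∑ l ∈ Finset.range i, d (K + l + 1) + d (K + i)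
      ≤ d K + M * (e K ^ (1 - θ) - e (K + i) ^ (1 - θ)) → e (K + i) ^ θ ≤ C * d (K + i) := by
    intro i hi
    have hψi : 0 ≤ M * e (K + i) ^ (1 - θ) := by have := hpos (K + i) (by omega); positivity
    have hb : ∑ l ∈ Finset.range i, d (K + l + 1) + d (K + i) < r / 2 := by
      rw [mul_sub] at hi; linarith
    have hwi : dist (w (K + i)) ws ≤ ∑ l ∈ Finset.range i, d (K + l + 1) + dist (w K) ws :=
      (dist_triangle _ (w K) _).trans (by gcongr; exact hdist i)
    have hwi' : dist (w (K + i - 1)) ws ≤ d (K + i) + dist (w (K + i)) ws := by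
      refine (dist_triangle _ (w (K + i)) _).trans ?_
      gcongr
      have := hwd (K + i - 1)
      rwa [Nat.sub_add_cancel (by omega), dist_comm] at this
    have := hd (K + i)
    exact hkl (K + i) (by omega) (by linarith) (by linarith) (hN _ (by omega))
  -- The additional summand `d (K + i)` lets the estimate `2 d_{i+1} ≤ d_i + …` telescope, and it
  -- also controls the previous iterate.
  have main : ∀ i, ∑ l ∈ Finset.range i, d (K + l + 1) + d (K + i)
      ≤ d K + M * (e K ^ (1 - θ) - e (K + i) ^ (1 - θ)) := by
    intro i
    induction i with
    | zero => simp
    | succ i ih =>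
      have h2 := two_mul_le_of_desingularization ha hC h0 h1 (hpos (K + i + 1) (by omega))
        (hpos (K + i) (by omega)) (hd _) (hdec (K + i) (by omega)) (near i ih)
      rw [← hM] at h2
      rw [Finset.sum_range_succ, ← add_assoc]
      rw [mul_sub] at *
      linarith
  refine ⟨K, hK1, fun k hk => ?_⟩
  obtain ⟨i, rfl⟩ := Nat.exists_eq_add_of_le hk
  exact near i (main i)

/-! ### Smallest eigenvalues of symmetric matrices -/

section Eigenvalues

variable {d r : ℕ}

theorem lamMin_mul_sq_le {M : Vec d →L[ℝ] Vec d} (hM : (M : Vec d →ₗ[ℝ] Vec d).IsSymmetric)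
    (w : Vec d) : lamMin M * ‖w‖ ^ 2 ≤ ⟪w, M w⟫_ℝ := by
  have hd : Module.finrank ℝ (Vec d) = d := by simp
  let u := hM.eigenvectorBasis hd
  have h1 : ⟪w, M w⟫_ℝ = ∑ i, hM.eigenvalues hd i * ⟪u i, w⟫_ℝ ^ 2 := by
    rw [← u.sum_inner_mul_inner]
    refine Finset.sum_congr rfl fun i _ => ?_
    have : ⟪u i, M w⟫_ℝ = hM.eigenvalues hd i * ⟪u i, w⟫_ℝ := by
      have h := hM (u i) w
      simp only [ContinuousLinearMap.coe_coe] at h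
      rw [← h]
      have := hM.apply_eigenvectorBasis hd i
      simp only [ContinuousLinearMap.coe_coe] at this
      rw [this, inner_smul_left]; simp [u]
    rw [this, real_inner_comm]; ring
  rw [h1, ← u.sum_sq_norm_inner_right, Finset.mul_sum]
  refine Finset.sum_le_sum fun i _ => ?_
  rw [Real.norm_eq_abs, sq_abs]
  gcongr
  exact csInf_le (Module.End.finite_hasEigenvalue _).bddBelow (hM.hasEigenvalue_eigenvalues hd i)

/-- In an eigenbasis of `BᵀB`, with eigenvalues `μ i`, `‖Bw‖²` has weights `μ i` and `‖BᵀBw‖²` has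
weights `μ i ^ 2`. Zero eigenvalues contribute to neither, so only positive ones are compared. -/
theorem lamPos_gram {B : Vec d →L[ℝ] Vec r} (hB : B ≠ 0) :
    0 < lamPos (B.adjoint ∘L B) ∧
      ∀ v ∈ Set.range B, lamPos (B.adjoint ∘L B) * ‖v‖ ^ 2 ≤ ‖B.adjoint v‖ ^ 2 := by
  set M := B.adjoint ∘L B with hMdef
  have hM : (M : Vec d →ₗ[ℝ] Vec d).IsSymmetric := by
    intro a b
    simp [hMdef, ContinuousLinearMap.adjoint_inner_left, ContinuousLinearMap.adjoint_inner_right]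
  have hd : Module.finrank ℝ (Vec d) = d := by simp
  let u := hM.eigenvectorBasis hd
  let μ := hM.eigenvalues hd
  have hu : ∀ w i, ⟪u i, M w⟫_ℝ = μ i * ⟪u i, w⟫_ℝ := by
    intro w i
    have h := hM (u i) w
    simp only [ContinuousLinearMap.coe_coe] at h
    rw [← h]
    have := hM.apply_eigenvectorBasis hd i
    simp only [ContinuousLinearMap.coe_coe] at this
    rw [this, inner_smul_left]; simp [μ, u]
  have h1 : ∀ w, ‖B w‖ ^ 2 = ∑ i, μ i * ⟪u i, w⟫_ℝ ^ 2 := by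
    intro w
    have : ‖B w‖ ^ 2 = ⟪w, M w⟫_ℝ := by
      rw [hMdef, ContinuousLinearMap.comp_apply, ContinuousLinearMap.adjoint_inner_right,
        real_inner_self_eq_norm_sq]
    rw [this, ← u.sum_inner_mul_inner]
    refine Finset.sum_congr rfl fun i _ => ?_
    rw [hu, real_inner_comm]; ring
  have h2 : ∀ w, ‖M w‖ ^ 2 = ∑ i, μ i ^ 2 * ⟪u i, w⟫_ℝ ^ 2 := by
    intro w
    rw [← u.sum_sq_norm_inner_right]
    refine Finset.sum_congr rfl fun i _ => ?_
    rw [hu, Real.norm_eq_abs, sq_abs]; ring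
  have hμ : ∀ i, 0 ≤ μ i := by
    intro i
    have h := hu (u i) i
    have h' : ⟪u i, M (u i)⟫_ℝ = ‖B (u i)‖ ^ 2 := by
      rw [hMdef, ContinuousLinearMap.comp_apply, ContinuousLinearMap.adjoint_inner_right,
        real_inner_self_eq_norm_sq]
    have h3 : ⟪u i, u i⟫_ℝ = 1 := by rw [real_inner_self_eq_norm_sq, u.norm_eq_one]; norm_num
    rw [h3, h', mul_one] at h
    rw [← h]; positivity
  have hfin : {t : ℝ | 0 < t ∧ Module.End.HasEigenvalue (M : Vec d →ₗ[ℝ] Vec d) t}.Finite :=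
    (Module.End.finite_hasEigenvalue _).subset fun t ht => ht.2
  have hle : ∀ i, 0 < μ i → lamPos M ≤ μ i := fun i hi =>
    csInf_le hfin.bddBelow ⟨hi, hM.hasEigenvalue_eigenvalues hd i⟩
  constructor
  · have hne : {t : ℝ | 0 < t ∧ Module.End.HasEigenvalue (M : Vec d →ₗ[ℝ] Vec d) t}.Nonempty := by
      by_contra hemp
      apply hB
      ext1 w
      have : ‖B w‖ ^ 2 = 0 := by
        rw [h1]
        refine Finset.sum_eq_zero fun i _ => ?_
        have : μ i = 0 := by
          by_contra hi
          exact hemp ⟨μ i, lt_of_le_of_ne (hμ i) (Ne.symm hi), hM.hasEigenvalue_eigenvalues hd i⟩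
        rw [this, zero_mul]
      simpa using this
    exact (hne.csInf_mem hfin).1
  · rintro _ ⟨w, rfl⟩
    have : B.adjoint (B w) = M w := rfl
    rw [this, h1, h2, Finset.mul_sum]
    refine Finset.sum_le_sum fun i _ => ?_
    rw [← mul_assoc, sq (μ i)]
    refine mul_le_mul_of_nonneg_right ?_ (sq_nonneg _)
    rcases (hμ i).eq_or_lt with h | h
    · rw [← h]; simp
    · exact mul_le_mul_of_nonneg_right (hle i h) h.le

end Eigenvalues

/-! ### Relaxed recursions and the descent lemma -/

section Inequalities

variable {E F : Type*} [NormedAddCommGroup E] [InnerProductSpace ℝ E]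
  [NormedAddCommGroup F] [InnerProductSpace ℝ F]

/-- Convexity of the square with weights `|1 - β|` and `1 - |1 - β|`, which is where `β ∈ (0, 2)`
enters. -/
theorem norm_sq_relaxation_le {β : ℝ} (h0 : 0 < β) (h2 : β < 2) (a u : E) :
    ‖(1 - β) • a + β • u‖ ^ 2
      ≤ |1 - β| * ‖a‖ ^ 2 + β ^ 2 / (1 - |1 - β|) * ‖u‖ ^ 2 := by
  have hs : |1 - β| < 1 := abs_lt.2 ⟨by linarith, by linarith⟩
  have hs0 := abs_nonneg (1 - β)
  have hn : ‖(1 - β) • a + β • u‖ ≤ |1 - β| * ‖a‖ + β * ‖u‖ := by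
    refine (norm_add_le _ _).trans (le_of_eq ?_)
    rw [norm_smul, norm_smul, Real.norm_eq_abs, Real.norm_eq_abs, abs_of_pos h0]
  set s := |1 - β|
  have hρ : 0 < 1 - s := by linarith
  have hn2 := pow_le_pow_left₀ (norm_nonneg _) hn 2
  refine hn2.trans ?_
  have : s * ‖a‖ ^ 2 + β ^ 2 / (1 - s) * ‖u‖ ^ 2 - (s * ‖a‖ + β * ‖u‖) ^ 2
      = s / (1 - s) * ((1 - s) * ‖a‖ - β * ‖u‖) ^ 2 := by
    field_simp; ring
  have : 0 ≤ s / (1 - s) * ((1 - s) * ‖a‖ - β * ‖u‖) ^ 2 := by positivity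
  linarith

/-- The descent lemma for a function with `L`-Lipschitz gradient. -/
theorem descent_of_lipschitz_gradient [CompleteSpace E] {h : E → ℝ} {L : ℝ}
    (hh : Differentiable ℝ h) (hL : ∀ u v, ‖gradient h v - gradient h u‖ ≤ L * ‖v - u‖)
    (u v : E) : h v + ⟪gradient h v, u - v⟫_ℝ - L / 2 * ‖u - v‖ ^ 2 ≤ h u := by
  set D := u - v with hD
  -- The claim is `ψ 0 ≤ ψ 1`; the quadratic term is chosen so that the Lipschitz bound makes `ψ'`
  -- nonnegative on the open interval.
  let ψ : ℝ → ℝ := fun t => h (v + t • D) - t * ⟪gradient h v, D⟫_ℝ + L / 2 * ‖D‖ ^ 2 * t ^ 2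
  have hψ : ∀ t, HasDerivAt ψ
      (⟪gradient h (v + t • D), D⟫_ℝ - ⟪gradient h v, D⟫_ℝ + L / 2 * ‖D‖ ^ 2 * (2 * t)) t := by
    intro t
    have h1 : HasDerivAt (fun t : ℝ => v + t • D) D t := by
      simpa using ((hasDerivAt_id t).smul_const D).const_add v
    have h2 := ((hh (v + t • D)).hasGradientAt.hasFDerivAt).comp_hasDerivAt t h1
    have h3 := (hasDerivAt_id t).mul_const ⟪gradient h v, D⟫_ℝ
    have h4 := (hasDerivAt_pow 2 t).const_mul (L / 2 * ‖D‖ ^ 2)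
    refine ((h2.sub h3).add h4).congr_deriv ?_
    rw [InnerProductSpace.toDual_apply_apply]; ring
  have hmono : MonotoneOn ψ (Set.Icc 0 1) := by
    refine monotoneOn_of_deriv_nonneg (convex_Icc 0 1)
      (fun t _ => (hψ t).continuousAt.continuousWithinAt)
      (fun t _ => (hψ t).differentiableAt.differentiableWithinAt) fun t ht => ?_
    rw [interior_Icc] at ht
    rw [(hψ t).deriv, ← inner_sub_left]
    have h1 := abs_real_inner_le_norm (gradient h (v + t • D) - gradient h v) D
    have h2 := hL v (v + t • D)
    rw [add_sub_cancel_left, norm_smul, Real.norm_eq_abs, abs_of_pos ht.1] at h2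
    have h3 := mul_le_mul_of_nonneg_right h2 (norm_nonneg D)
    have h4 := (abs_le.1 h1).1
    nlinarith
  have h01 := hmono (Set.left_mem_Icc.2 zero_le_one) (Set.right_mem_Icc.2 zero_le_one) zero_le_one
  simp only [ψ, zero_smul, one_smul, add_zero, one_mul, zero_mul, one_pow, mul_one, sub_zero,
    zero_pow two_ne_zero, mul_zero] at h01
  rw [hD, add_sub_cancel, ← hD] at h01
  linarith

end Inequalities

/-! ### Extended-real sums -/

theorem ereal_coe_sum {ι : Type*} (s : Finset ι) (g : ι → ℝ) :
    ((∑ i ∈ s, g i : ℝ) : EReal) = ∑ i ∈ s, (g i : EReal) := by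
  classical
  induction s using Finset.induction_on with
  | empty => simp
  | insert i s hi ih => rw [Finset.sum_insert hi, Finset.sum_insert hi, EReal.coe_add, ih]

theorem ereal_sum_ne_bot {ι : Type*} (s : Finset ι) {g : ι → EReal} (hg : ∀ i ∈ s, g i ≠ ⊥) :
    ∑ i ∈ s, g i ≠ ⊥ := by
  classical
  induction s using Finset.induction_on with
  | empty => simp
  | insert i s hi ih =>
    rw [Finset.sum_insert hi, EReal.add_ne_bot_iff]
    exact ⟨hg i (by simp), ih fun j hj => hg j (by simp [hj])⟩

theorem ereal_add_coe_sub_le {u v : EReal} {s t : ℝ}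
    (h : u + (s : EReal) ≤ v + (t : EReal)) : u + ((s - t : ℝ) : EReal) ≤ v := by
  refine (EReal.addLECancellable_coe t).add_le_add_iff_right.1 ?_
  rwa [add_assoc, ← EReal.coe_add, sub_add_cancel]

/-! ### Quadratic minorants and subgradients -/

section Subdifferential

variable {E : Type*} [NormedAddCommGroup E] [InnerProductSpace ℝ E]

theorem frechetSubdiff_subset_limSubdiff (Φ : E → EReal) (a : E) :
    frechetSubdiff Φ a ⊆ limSubdiff Φ a := fun s hs =>
  ⟨hs.1, fun _ => a, fun _ => s, tendsto_const_nhds, tendsto_const_nhds, fun _ => hs,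
    tendsto_const_nhds⟩

theorem mem_limSubdiff_of_quadratic_minorant {Φ : E → EReal} {a s : E} {K : ℝ} (ha : Φ a ≠ ⊤)
    (h : ∀ w, Φ a + ((⟪s, w - a⟫_ℝ - K * ‖w - a‖ ^ 2 : ℝ) : EReal) ≤ Φ w) :
    s ∈ limSubdiff Φ a := by
  refine frechetSubdiff_subset_limSubdiff _ _ ⟨ha, fun ε hε => ?_⟩
  have hK : 0 < ε / (|K| + 1) := by positivity
  filter_upwards [Metric.ball_mem_nhds a hK] with w hw
  refine le_trans (add_le_add le_rfl (EReal.coe_le_coe_iff.2 ?_)) (h w)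
  rw [Metric.mem_ball, dist_eq_norm, lt_div_iff₀ (by positivity)] at hw
  have h1 := le_abs_self K
  have h2 := norm_nonneg (w - a)
  nlinarith [mul_le_mul_of_nonneg_right hw.le h2]

theorem eq_zero_of_quadratic_nonneg {v : E} {K : ℝ} (h : ∀ w, 0 ≤ ⟪v, w⟫_ℝ + K * ‖w‖ ^ 2) :
    v = 0 := by
  by_contra hv
  have hv' : 0 < ‖v‖ ^ 2 := by positivity
  have ht : 0 < |K| + 1 := by positivity
  -- A step against `v`, short enough that the linear term beats the quadratic one.
  have h1 := h (-(1 / (|K| + 1)) • v)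
  rw [inner_smul_right, real_inner_self_eq_norm_sq, norm_smul, mul_pow, Real.norm_eq_abs, sq_abs]
    at h1
  have h2 : K * (1 / (|K| + 1)) < 1 := by
    rw [mul_one_div, div_lt_one ht]
    linarith [le_abs_self K]
  have h3 : 0 < 1 / (|K| + 1) := by positivity
  nlinarith [mul_pos h3 hv']

theorem ascent_of_lipschitz_gradient [CompleteSpace E] {h : E → ℝ} {L : ℝ}
    (hh : Differentiable ℝ h) (hL : ∀ u v, ‖gradient h v - gradient h u‖ ≤ L * ‖v - u‖)
    (u v : E) : h u ≤ h v + ⟪gradient h v, u - v⟫_ℝ + L / 2 * ‖u - v‖ ^ 2 := by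
  have hg : ∀ w, gradient (fun x => -h x) w = -gradient h w := by
    intro w
    rw [gradient, gradient, ← map_neg]
    congr 1
    exact fderiv_fun_neg
  have := descent_of_lipschitz_gradient (h := fun x => -h x) (L := L) hh.neg
    (fun a b => by rw [hg, hg, neg_sub_neg, norm_sub_rev]; exact hL a b) u v
  rw [hg, inner_neg_left] at this
  linarith

end Subdifferential

/-! ### Proximal linearly coupled quadratic functions -/

section CouplingQuadratic

variable {E F : Type*} [NormedAddCommGroup E] [InnerProductSpace ℝ E]
  [NormedAddCommGroup F] [InnerProductSpace ℝ F]

/-- The function `w ↦ ⟪z, r⟫ + α / 2 ‖r‖²` with `r = A w + c`. -/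
noncomputable def coupling (A : E →L[ℝ] F) (c z : F) (α : ℝ) (w : E) : ℝ :=
  ⟪z, A w + c⟫_ℝ + α / 2 * ‖A w + c‖ ^ 2

theorem prox_expand {Q : E →L[ℝ] E} (hQ : Q.IsPositive) (a b w : E) :
    ⟪w - b, Q (w - b)⟫_ℝ = ⟪a - b, Q (a - b)⟫_ℝ + 2 * ⟪Q (a - b), w - a⟫_ℝ
      + ⟪w - a, Q (w - a)⟫_ℝ := by
  have h : w - b = (a - b) + (w - a) := by abel
  have hs : ⟪a - b, Q (w - a)⟫_ℝ = ⟪Q (a - b), w - a⟫_ℝ := (hQ.1 _ _).symm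
  rw [h, map_add, inner_add_left, inner_add_right, inner_add_right, hs,
    real_inner_comm (Q (a - b)) (w - a)]
  ring

variable {A : E →L[ℝ] F} {c z : F} {α : ℝ}

theorem prox_coupling_remainder_le (hα : 0 < α) (Q : E →L[ℝ] E) (w : E) :
    α / 2 * ‖A w‖ ^ 2 + 1 / 2 * ⟪w, Q w⟫_ℝ ≤ (α / 2 * ‖A‖ ^ 2 + 1 / 2 * ‖Q‖) * ‖w‖ ^ 2 := by
  have h1 := pow_le_pow_left₀ (norm_nonneg _) (A.le_opNorm w) 2
  have h2 := real_inner_le_norm w (Q w)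
  have h3 := mul_le_mul_of_nonneg_left (Q.le_opNorm w) (norm_nonneg w)
  have h4 := mul_le_mul_of_nonneg_left h1 hα.le
  nlinarith

theorem prox_min_decrease_of_coercive {f : E → EReal} {a b : E} {Q : E →L[ℝ] E} {φa φb τ : ℝ}
    (hmin : ∀ w, f a + ((coupling A c z α a + 1 / 2 * ⟪a - b, Q (a - b)⟫_ℝ
      - (coupling A c z α w + 1 / 2 * ⟪w - b, Q (w - b)⟫_ℝ) : ℝ) : EReal) ≤ f w)
    (ha : f a = φa) (hb : f b = φb) (hτ : ∀ w, τ * ‖w‖ ^ 2 ≤ ⟪w, Q w⟫_ℝ) :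
    φa + coupling A c z α a + τ / 2 * ‖a - b‖ ^ 2 ≤ φb + coupling A c z α b := by
  have h := hmin b
  rw [ha, hb, ← EReal.coe_add, EReal.coe_le_coe_iff] at h
  simp only [sub_self, map_zero, inner_zero_left] at h
  have := hτ (a - b)
  linarith

variable [CompleteSpace E] [CompleteSpace F]

theorem coupling_expand (A : E →L[ℝ] F) (c z : F) (α : ℝ) (a w : E) :
    coupling A c z α w = coupling A c z α a + ⟪A.adjoint (z + α • (A a + c)), w - a⟫_ℝ
      + α / 2 * ‖A (w - a)‖ ^ 2 := by
  have h : A w + c = (A a + c) + A (w - a) := by rw [map_sub]; abel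
  unfold coupling
  rw [h, norm_add_sq_real, ContinuousLinearMap.adjoint_inner_left, inner_add_right, inner_add_left z,
    inner_smul_left]
  simp only [conj_trivial]
  ring

/-- A minimizer of `f + coupling + ½ ‖· - b‖²_Q` provides a quadratic minorant of `f`. -/
theorem quadratic_minorant_of_prox_min {f : E → EReal} {a b : E} {Q : E →L[ℝ] E} (hα : 0 < α)
    (hQ : Q.IsPositive)
    (hmin : ∀ w, f a + ((coupling A c z α a + 1 / 2 * ⟪a - b, Q (a - b)⟫_ℝ
      - (coupling A c z α w + 1 / 2 * ⟪w - b, Q (w - b)⟫_ℝ) : ℝ) : EReal) ≤ f w) (w : E) :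
    f a + ((⟪-(A.adjoint (z + α • (A a + c)) + Q (a - b)), w - a⟫_ℝ
      - (α / 2 * ‖A‖ ^ 2 + 1 / 2 * ‖Q‖) * ‖w - a‖ ^ 2 : ℝ) : EReal) ≤ f w := by
  refine le_trans (add_le_add le_rfl (EReal.coe_le_coe_iff.2 ?_)) (hmin w)
  rw [coupling_expand A c z α a w, prox_expand hQ a b w, inner_neg_left, inner_add_left]
  have := prox_coupling_remainder_le (A := A) hα Q (w - a)
  linarith

/-- Weak convexity is applied with the subgradient supplied by minimality. It loses `ε / 2 ‖a -
b‖²`, while the exact expansion of the coupling at `a` gains `α / 2 ‖A (a - b)‖²`; the proximal term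
only helps. -/
theorem prox_min_decrease_of_weaklyConvex {f : E → EReal} {a b : E} {Q : E →L[ℝ] E}
    {φa φb τ ε : ℝ} (hα : 0 < α) (hQ : Q.IsPositive)
    (hmin : ∀ w, f a + ((coupling A c z α a + 1 / 2 * ⟪a - b, Q (a - b)⟫_ℝ
      - (coupling A c z α w + 1 / 2 * ⟪w - b, Q (w - b)⟫_ℝ) : ℝ) : EReal) ≤ f w)
    (ha : f a = φa) (hb : f b = φb) (hf : WeaklyConvex f ε)
    (hτ : ∀ w, τ * ‖w‖ ^ 2 ≤ α * ‖A w‖ ^ 2 - ε * ‖w‖ ^ 2) :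
    φa + coupling A c z α a + τ / 2 * ‖a - b‖ ^ 2 ≤ φb + coupling A c z α b := by
  have hs := mem_limSubdiff_of_quadratic_minorant (by simp [ha])
    (quadratic_minorant_of_prox_min hα hQ hmin)
  have h := hf b a _ hs
  rw [ha, hb, ← EReal.coe_add, EReal.coe_le_coe_iff, inner_neg_left, inner_add_left] at h
  have h1 := coupling_expand A c z α a b
  have h2 : ⟪Q (a - b), b - a⟫_ℝ = -⟪a - b, Q (a - b)⟫_ℝ := by
    rw [← neg_sub a b, inner_neg_right, real_inner_comm]
  have h3 : 0 ≤ ⟪a - b, Q (a - b)⟫_ℝ := by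
    have := hQ.inner_nonneg_right (a - b)
    simpa using this
  have h4 := hτ (b - a)
  rw [norm_sub_rev a b]
  linarith

/-- The upper quadratic bound for `h` makes the objective increment at most a linear form plus a
quadratic one; as the increment is nonnegative, the linear form vanishes. -/
theorem prox_min_gradient {h : E → ℝ} {a b : E} {P : E →L[ℝ] E} {L : ℝ} (hα : 0 < α)
    (hP : P.IsPositive) (hh : Differentiable ℝ h)
    (hL : ∀ u v, ‖gradient h v - gradient h u‖ ≤ L * ‖v - u‖)
    (hmin : ∀ w, h a + coupling A c z α a + 1 / 2 * ⟪a - b, P (a - b)⟫_ℝ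
      ≤ h w + coupling A c z α w + 1 / 2 * ⟪w - b, P (w - b)⟫_ℝ) :
    gradient h a + A.adjoint (z + α • (A a + c)) + P (a - b) = 0 := by
  refine eq_zero_of_quadratic_nonneg (K := L / 2 + (α / 2 * ‖A‖ ^ 2 + 1 / 2 * ‖P‖)) fun w => ?_
  have h1 := hmin (a + w)
  have h2 := ascent_of_lipschitz_gradient hh hL (a + w) a
  have h3 := coupling_expand A c z α a (a + w)
  have h4 := prox_expand hP a b (a + w)
  rw [add_sub_cancel_left] at h2 h3 h4
  have h5 := prox_coupling_remainder_le (A := A) hα P w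
  rw [inner_add_left, inner_add_left]
  linarith

/-- Using stationarity rather than comparing objective values yields the full form `⟪Δy, P Δy⟫`
instead of half of it, hence `2P` in `matD`. -/
theorem prox_min_decrease_of_lipschitz {h : E → ℝ} {a b : E} {P : E →L[ℝ] E} {L : ℝ}
    (hh : Differentiable ℝ h) (hL : ∀ u v, ‖gradient h v - gradient h u‖ ≤ L * ‖v - u‖)
    (hgrad : gradient h a + A.adjoint (z + α • (A a + c)) + P (a - b) = 0) :
    h a + coupling A c z α a + (⟪a - b, P (a - b)⟫_ℝ + α / 2 * ‖A (a - b)‖ ^ 2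
      - L / 2 * ‖a - b‖ ^ 2) ≤ h b + coupling A c z α b := by
  have h1 := descent_of_lipschitz_gradient hh hL b a
  have h2 := coupling_expand A c z α a b
  have h3 : ⟪gradient h a + A.adjoint (z + α • (A a + c)) + P (a - b), b - a⟫_ℝ = 0 := by
    rw [hgrad, inner_zero_left]
  rw [inner_add_left, inner_add_left] at h3
  have h4 : ⟪P (a - b), b - a⟫_ℝ = -⟪a - b, P (a - b)⟫_ℝ := by
    rw [← neg_sub a b, inner_neg_right, real_inner_comm]
  have h5 : A (a - b) = -A (b - a) := by rw [← map_neg, neg_sub]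
  rw [h5, norm_neg, norm_sub_rev a b]
  linarith

end CouplingQuadratic

/-! ### The product space of the Lyapunov function -/

section LyapSpace

variable {p : ℕ} {n : Fin p → ℕ} {q m : ℕ}

theorem exists_eq_lyapPoint (u : LyapSpace n q m) :
    ∃ x y z y' z', u = lyapPoint x y z y' z' :=
  ⟨fun i => u.fst i, u.snd.fst, u.snd.snd.fst, u.snd.snd.snd.fst, u.snd.snd.snd.snd, rfl⟩

theorem lyapPoint_sub (x₁ x₂ : ∀ i, Vec (n i)) (y₁ y₂ : Vec q) (z₁ z₂ : Vec m) (y₁' y₂' : Vec q)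
    (z₁' z₂' : Vec m) :
    lyapPoint x₁ y₁ z₁ y₁' z₁' - lyapPoint x₂ y₂ z₂ y₂' z₂'
      = lyapPoint (fun i => x₁ i - x₂ i) (y₁ - y₂) (z₁ - z₂) (y₁' - y₂') (z₁' - z₂') := rfl

theorem inner_lyapPoint (x₁ x₂ : ∀ i, Vec (n i)) (y₁ y₂ : Vec q) (z₁ z₂ : Vec m)
    (y₁' y₂' : Vec q) (z₁' z₂' : Vec m) :
    ⟪lyapPoint x₁ y₁ z₁ y₁' z₁', lyapPoint x₂ y₂ z₂ y₂' z₂'⟫_ℝ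
      = ∑ i, ⟪x₁ i, x₂ i⟫_ℝ + ⟪y₁, y₂⟫_ℝ + ⟪z₁, z₂⟫_ℝ + ⟪y₁', y₂'⟫_ℝ + ⟪z₁', z₂'⟫_ℝ := by
  simp only [lyapPoint, WithLp.prod_inner_apply, PiLp.inner_apply]
  ring

theorem norm_sq_lyapPoint (x : ∀ i, Vec (n i)) (y : Vec q) (z : Vec m) (y' : Vec q) (z' : Vec m) :
    ‖lyapPoint x y z y' z'‖ ^ 2
      = ∑ i, ‖x i‖ ^ 2 + ‖y‖ ^ 2 + ‖z‖ ^ 2 + ‖y'‖ ^ 2 + ‖z'‖ ^ 2 := by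
  simp only [← real_inner_self_eq_norm_sq, inner_lyapPoint]

theorem norm_lyapPoint_le (x : ∀ i, Vec (n i)) (y : Vec q) (z : Vec m) (y' : Vec q) (z' : Vec m) :
    ‖lyapPoint x y z y' z'‖ ≤ ∑ i, ‖x i‖ + ‖y‖ + ‖z‖ + ‖y'‖ + ‖z'‖ := by
  have h0 : 0 ≤ ∑ i, ‖x i‖ := Finset.sum_nonneg fun i _ => norm_nonneg _
  refine le_of_sq_le_sq ?_ (by positivity)
  rw [norm_sq_lyapPoint]
  have h := Finset.sum_sq_le_sq_sum_of_nonneg (s := Finset.univ) (f := fun i => ‖x i‖)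
    fun i _ => norm_nonneg _
  have := norm_nonneg y
  have := norm_nonneg z
  have := norm_nonneg y'
  have := norm_nonneg z'
  have h1 : 0 ≤ (∑ i, ‖x i‖) * (‖y‖ + ‖z‖ + ‖y'‖ + ‖z'‖) := by positivity
  have h2 : 0 ≤ ‖y‖ * (‖z‖ + ‖y'‖ + ‖z'‖) := by positivity
  have h3 : 0 ≤ ‖z‖ * (‖y'‖ + ‖z'‖) := by positivity
  have h4 : 0 ≤ ‖y'‖ * ‖z'‖ := by positivity
  nlinarith

end LyapSpace

/-! ### Minorants and subgradients of the Lyapunov function -/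

theorem norm_sq_comp_tangent {E F : Type*} [NormedAddCommGroup E] [InnerProductSpace ℝ E]
    [CompleteSpace E] [NormedAddCommGroup F] [InnerProductSpace ℝ F] [CompleteSpace F]
    (T : E →L[ℝ] F) (u v : E) :
    ‖T v‖ ^ 2 + 2 * ⟪T.adjoint (T v), u - v⟫_ℝ ≤ ‖T u‖ ^ 2 := by
  have h : T u = T v + T (u - v) := by rw [map_sub]; abel
  rw [h, norm_add_sq_real, ContinuousLinearMap.adjoint_inner_left]
  nlinarith [sq_nonneg ‖T (u - v)‖]

namespace Data

variable {p : ℕ} {n : Fin p → ℕ} {q m : ℕ} (S : Data p n q m)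

/-- The real-valued part of the augmented Lagrangian. -/
noncomputable def smoothLag (x : ∀ i, Vec (n i)) (y : Vec q) (z : Vec m) : ℝ :=
  S.h y + ⟪z, S.residual x y⟫_ℝ + S.α / 2 * ‖S.residual x y‖ ^ 2

/-- The quadratic terms that the Lyapunov function adds to the augmented Lagrangian. -/
noncomputable def lyapTail (y : Vec q) (z : Vec m) (y' : Vec q) (z' : Vec m) : ℝ :=
  S.ε₀ * S.c5 * ‖S.B.adjoint (z - z')‖ ^ 2 + S.ε₀ * S.c3 * ‖y - y'‖ ^ 2

theorem Lbar_lyapPoint (x : ∀ i, Vec (n i)) (y : Vec q) (z : Vec m) (y' : Vec q) (z' : Vec m) :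
    S.Lbar (lyapPoint x y z y' z')
      = ∑ i, S.f i (x i) + ((S.smoothLag x y z + S.lyapTail y z y' z' : ℝ) : EReal) := by
  rw [EReal.coe_add, ← add_assoc]
  rfl

theorem Lbar_eq_coe {x : ∀ i, Vec (n i)} {F : Fin p → ℝ} (hF : ∀ i, S.f i (x i) = F i) (y : Vec q)
    (z : Vec m) (y' : Vec q) (z' : Vec m) :
    S.Lbar (lyapPoint x y z y' z')
      = ((∑ i, F i + (S.smoothLag x y z + S.lyapTail y z y' z') : ℝ) : EReal) := by
  rw [Lbar_lyapPoint, EReal.coe_add (∑ i, F i), ereal_coe_sum]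
  simp only [hF]

theorem residual_sub (x x' : ∀ i, Vec (n i)) (y y' : Vec q) :
    S.residual x' y' - S.residual x y = ∑ i, S.A i (x' i - x i) + S.B (y' - y) := by
  simp only [residual, map_sub, Finset.sum_sub_distrib]
  abel

theorem norm_residual_sub_le (x x' : ∀ i, Vec (n i)) (y y' : Vec q) {N : ℝ}
    (hx : ∀ i, ‖x' i - x i‖ ≤ N) (hy : ‖y' - y‖ ≤ N) :
    ‖S.residual x' y' - S.residual x y‖ ≤ (∑ i, ‖S.A i‖ + ‖S.B‖) * N := by
  rw [residual_sub, add_mul, Finset.sum_mul]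
  refine (norm_add_le _ _).trans (add_le_add ((norm_sum_le _ _).trans ?_) ?_)
  · exact Finset.sum_le_sum fun i _ => (S.A i).le_of_opNorm_le_of_le le_rfl (hx i)
  · exact S.B.le_of_opNorm_le_of_le le_rfl hy

/-- Nonconvexity has two sources, `h` and the bilinear pairing of `z` with the residual. Each costs
a second-order error, and the penalty term is convex. -/
theorem smoothLag_quadratic_minorant (hα : 0 < S.α) (h2 : S.A2) (x x' : ∀ i, Vec (n i))
    (y y' : Vec q) (z z' : Vec m) :
    S.smoothLag x y z + (∑ i, ⟪(S.A i).adjoint (z + S.α • S.residual x y), x' i - x i⟫_ℝ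
      + ⟪gradient S.h y + S.B.adjoint (z + S.α • S.residual x y), y' - y⟫_ℝ
      + ⟪S.residual x y, z' - z⟫_ℝ) - S.Lh / 2 * ‖y' - y‖ ^ 2
      - ‖z' - z‖ * ‖S.residual x' y' - S.residual x y‖ ≤ S.smoothLag x' y' z' := by
  have hh := descent_of_lipschitz_gradient h2.2.1 h2.2.2 y' y
  set r := S.residual x y with hr
  have hδ := S.residual_sub x x' y y'
  set δ := S.residual x' y' - r with hδr
  have hr' : S.residual x' y' = r + δ := by rw [hδr]; abel
  have e1 : ⟪z + S.α • r, δ⟫_ℝ = ∑ i, ⟪(S.A i).adjoint (z + S.α • r), x' i - x i⟫_ℝ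
      + ⟪S.B.adjoint (z + S.α • r), y' - y⟫_ℝ := by
    simp only [ContinuousLinearMap.adjoint_inner_left]
    rw [hδ, inner_add_right, inner_sum]
  have e2 : ⟪z', r + δ⟫_ℝ = ⟪z, r⟫_ℝ + ⟪z, δ⟫_ℝ + ⟪z' - z, r⟫_ℝ + ⟪z' - z, δ⟫_ℝ := by
    simp only [inner_add_right, inner_sub_left]; ring
  have e3 : ⟪z + S.α • r, δ⟫_ℝ = ⟪z, δ⟫_ℝ + S.α * ⟪r, δ⟫_ℝ := by
    rw [inner_add_left, inner_smul_left]; simp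
  have e4 := (abs_le.1 (abs_real_inner_le_norm (z' - z) δ)).1
  have e5 : 0 ≤ S.α / 2 * ‖δ‖ ^ 2 := by positivity
  unfold smoothLag
  rw [← hr, hr', e2, norm_add_sq_real, inner_add_left (gradient S.h y),
    real_inner_comm (z' - z) r]
  linarith

theorem lyapTail_quadratic_minorant (h3 : 0 ≤ S.ε₀ * S.c3) (h5 : 0 ≤ S.ε₀ * S.c5)
    (y₁ y₂ y₁' y₂' : Vec q) (z₁ z₂ z₁' z₂' : Vec m) :
    S.lyapTail y₁ z₁ y₁' z₁'
      + (⟪(2 * (S.ε₀ * S.c3)) • (y₁ - y₁'), y₂ - y₁⟫_ℝ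
      + ⟪(2 * (S.ε₀ * S.c5)) • S.B (S.B.adjoint (z₁ - z₁')), z₂ - z₁⟫_ℝ
      + ⟪-((2 * (S.ε₀ * S.c3)) • (y₁ - y₁')), y₂' - y₁'⟫_ℝ
      + ⟪-((2 * (S.ε₀ * S.c5)) • S.B (S.B.adjoint (z₁ - z₁'))), z₂' - z₁'⟫_ℝ)
      ≤ S.lyapTail y₂ z₂ y₂' z₂' := by
  have e1 := mul_le_mul_of_nonneg_left
    (norm_sq_comp_tangent (ContinuousLinearMap.id ℝ (Vec q)) (y₂ - y₂') (y₁ - y₁')) h3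
  have e2 := mul_le_mul_of_nonneg_left
    (norm_sq_comp_tangent S.B.adjoint (z₂ - z₂') (z₁ - z₁')) h5
  have d1 : y₂ - y₂' - (y₁ - y₁') = (y₂ - y₁) - (y₂' - y₁') := by abel
  have d2 : z₂ - z₂' - (z₁ - z₁') = (z₂ - z₁) - (z₂' - z₁') := by abel
  rw [ContinuousLinearMap.adjoint_id, d1, inner_sub_right] at e1
  rw [ContinuousLinearMap.adjoint_adjoint, d2, inner_sub_right] at e2
  simp only [ContinuousLinearMap.id_apply] at e1
  simp only [inner_neg_left, inner_smul_left, conj_trivial]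
  unfold lyapTail
  linarith

/-- Quadratic minorants of the `fᵢ` provide a subgradient of the Lyapunov function. -/
theorem lyapPoint_mem_limSubdiff_Lbar (hα : 0 < S.α) (h2 : S.A2) (h3 : 0 ≤ S.ε₀ * S.c3)
    (h5 : 0 ≤ S.ε₀ * S.c5) {x s : ∀ i, Vec (n i)} {F K : Fin p → ℝ}
    (hF : ∀ i, S.f i (x i) = F i)
    (hs : ∀ i w, S.f i (x i) + ((⟪s i, w - x i⟫_ℝ - K i * ‖w - x i‖ ^ 2 : ℝ) : EReal) ≤ S.f i w)
    (y y' : Vec q) (z z' : Vec m) :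
    lyapPoint (fun i => s i + (S.A i).adjoint (z + S.α • S.residual x y))
      (gradient S.h y + S.B.adjoint (z + S.α • S.residual x y) + (2 * (S.ε₀ * S.c3)) • (y - y'))
      (S.residual x y + (2 * (S.ε₀ * S.c5)) • S.B (S.B.adjoint (z - z')))
      (-((2 * (S.ε₀ * S.c3)) • (y - y')))
      (-((2 * (S.ε₀ * S.c5)) • S.B (S.B.adjoint (z - z'))))
      ∈ limSubdiff S.Lbar (lyapPoint x y z y' z') := by
  -- The three parts of the constant absorb the errors of the `fᵢ`, of `h` and of the bilinear term;
  -- every block increment is bounded by the full norm `N`.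
  refine mem_limSubdiff_of_quadratic_minorant
    (K := ∑ i, |K i| + |S.Lh| / 2 + (∑ i, ‖S.A i‖ + ‖S.B‖))
    (by rw [S.Lbar_eq_coe hF]; exact EReal.coe_ne_top _) fun u => ?_
  obtain ⟨x₂, y₂, z₂, y₂', z₂', rfl⟩ := exists_eq_lyapPoint u
  rw [S.Lbar_eq_coe hF, Lbar_lyapPoint, lyapPoint_sub, inner_lyapPoint]
  have hN2 := norm_sq_lyapPoint (fun i => x₂ i - x i) (y₂ - y) (z₂ - z) (y₂' - y') (z₂' - z')
  set N := ‖lyapPoint (fun i => x₂ i - x i) (y₂ - y) (z₂ - z) (y₂' - y') (z₂' - z')‖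
  have hN : 0 ≤ N := norm_nonneg _
  have hsum : 0 ≤ ∑ i, ‖x₂ i - x i‖ ^ 2 := Finset.sum_nonneg fun i _ => by positivity
  have hx : ∀ i, ‖x₂ i - x i‖ ^ 2 ≤ N ^ 2 := fun i => by
    have := Finset.single_le_sum (f := fun i => ‖x₂ i - x i‖ ^ 2) (fun i _ => by positivity)
      (Finset.mem_univ i)
    have := sq_nonneg ‖y₂ - y‖
    have := sq_nonneg ‖z₂ - z‖
    have := sq_nonneg ‖y₂' - y'‖
    have := sq_nonneg ‖z₂' - z'‖
    linarith
  have hy : ‖y₂ - y‖ ^ 2 ≤ N ^ 2 := by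
    nlinarith [sq_nonneg ‖z₂ - z‖, sq_nonneg ‖y₂' - y'‖, sq_nonneg ‖z₂' - z'‖]
  have hz : ‖z₂ - z‖ ^ 2 ≤ N ^ 2 := by
    nlinarith [sq_nonneg ‖y₂ - y‖, sq_nonneg ‖y₂' - y'‖, sq_nonneg ‖z₂' - z'‖]
  have hf : ((∑ i, (F i + (⟪s i, x₂ i - x i⟫_ℝ - K i * ‖x₂ i - x i‖ ^ 2)) : ℝ) : EReal)
      ≤ ∑ i, S.f i (x₂ i) := by
    rw [ereal_coe_sum]
    refine Finset.sum_le_sum fun i _ => ?_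
    rw [EReal.coe_add, ← hF]
    exact hs i (x₂ i)
  refine le_trans ?_ (add_le_add hf le_rfl)
  rw [← EReal.coe_add, ← EReal.coe_add, EReal.coe_le_coe_iff]
  have g1 := S.smoothLag_quadratic_minorant hα h2 x x₂ y y₂ z z₂
  have g2 := S.lyapTail_quadratic_minorant h3 h5 y y₂ y' y₂' z z₂ z' z₂'
  have g3 : S.Lh / 2 * ‖y₂ - y‖ ^ 2 ≤ |S.Lh| / 2 * N ^ 2 := by
    gcongr
    exact le_abs_self _
  have g4 : ‖z₂ - z‖ * ‖S.residual x₂ y₂ - S.residual x y‖ ≤ (∑ i, ‖S.A i‖ + ‖S.B‖) * N ^ 2 := by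
    have a1 := S.norm_residual_sub_le x x₂ y y₂ (fun i => le_of_sq_le_sq (hx i) hN)
      (le_of_sq_le_sq hy hN)
    have a2 := mul_le_mul (le_of_sq_le_sq hz hN) a1 (norm_nonneg _) hN
    linarith
  have g5 : ∑ i, K i * ‖x₂ i - x i‖ ^ 2 ≤ (∑ i, |K i|) * N ^ 2 := by
    rw [Finset.sum_mul]
    refine Finset.sum_le_sum fun i _ => ?_
    exact mul_le_mul (le_abs_self _) (hx i) (sq_nonneg _) (abs_nonneg _)
  simp only [Finset.sum_add_distrib, Finset.sum_sub_distrib, inner_add_left] at g1 g2 ⊢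
  linarith

end Data

namespace Data

variable {p : ℕ} {n : Fin p → ℕ} {q m : ℕ} {S : Data p n q m}

/-! ### Constants -/

theorem abs_one_sub_β_lt_one (hS : S.Standing) : |1 - S.β| < 1 :=
  abs_lt.2 ⟨by linarith [hS.β_lt_two], by linarith [hS.β_pos]⟩

theorem rho_pos (hS : S.Standing) : 0 < S.rho := by
  have := abs_one_sub_β_lt_one hS
  unfold rho
  linarith

theorem lamB_pos (hS : S.Standing) : 0 < S.lamB := (lamPos_gram hS.B_ne_zero).1

theorem c2_nonneg (hS : S.Standing) : 0 ≤ S.c2 := by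
  have := rho_pos hS
  have := lamB_pos hS
  have := hS.α_pos
  have := hS.β_pos
  unfold c2
  positivity

theorem ε₀_mul_c3_nonneg (hS : S.Standing) : 0 ≤ S.ε₀ * S.c3 := by
  have := c2_nonneg hS
  have := hS.one_lt_ε₀
  unfold c3
  positivity

theorem ε₀_mul_c5_nonneg (hS : S.Standing) : 0 ≤ S.ε₀ * S.c5 := by
  have := rho_pos hS
  have := lamB_pos hS
  have := hS.α_pos
  have := hS.β_pos
  have := hS.one_lt_ε₀
  unfold c5 c1
  positivity

theorem sigma_le_τ (S : Data p n q m) (τ : Fin p → ℝ) (i : Fin p) : S.sigma τ ≤ τ i :=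
  (min_le_right _ _).trans ((min_le_left _ _).trans (ciInf_le (Set.finite_range τ).bddBelow i))

theorem sigma_mul_norm_sq_le (hS : S.Standing) (τ : Fin p → ℝ) (w : Vec q) :
    S.sigma τ * ‖w‖ ^ 2 ≤ 2 * ⟪w, S.P w⟫_ℝ + S.α * ‖S.B w‖ ^ 2 - S.Lh * ‖w‖ ^ 2
      - 2 * S.ε₀ * (S.c3 + S.c4) * ‖w‖ ^ 2 := by
  have hsymm : (S.matDbar : Vec q →ₗ[ℝ] Vec q).IsSymmetric := by
    intro u v
    have hP : ⟪S.P u, v⟫_ℝ = ⟪u, S.P v⟫_ℝ := hS.P_psd.1 u v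
    simp [matDbar, matD, inner_sub_left, inner_sub_right, inner_add_left, inner_add_right,
      inner_smul_left, inner_smul_right, ContinuousLinearMap.adjoint_inner_left,
      ContinuousLinearMap.adjoint_inner_right, hP]
  have h := lamMin_mul_sq_le hsymm w
  have hq : ⟪w, S.matDbar w⟫_ℝ = 2 * ⟪w, S.P w⟫_ℝ + S.α * ‖S.B w‖ ^ 2 - S.Lh * ‖w‖ ^ 2
      - 2 * S.ε₀ * (S.c3 + S.c4) * ‖w‖ ^ 2 := by
    simp [matDbar, matD, inner_sub_right, inner_add_right, inner_smul_right,
      ContinuousLinearMap.adjoint_inner_right]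
  rw [← hq]
  exact (mul_le_mul_of_nonneg_right (min_le_left _ _) (sq_nonneg _)).trans h

/-! ### Block updates -/

theorem residual_update (S : Data p n q m) (X : ∀ i, Vec (n i)) (i : Fin p) (w : Vec (n i))
    (y : Vec q) : S.residual (Function.update X i w) y
      = S.A i w + S.residual (Function.update X i 0) y := by
  have h := S.residual_sub (Function.update X i 0) (Function.update X i w) y y
  rw [Finset.sum_eq_single i (fun j _ hj => by simp [Function.update_of_ne hj]) (by simp)] at h
  simp only [Function.update_self, sub_zero, sub_self, map_zero, add_zero] at h
  rw [← h]; abel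

theorem residual_eq_add (S : Data p n q m) (X : ∀ i, Vec (n i)) (w : Vec q) :
    S.residual X w = S.B w + S.residual X 0 := by
  simp only [residual, map_zero]; abel

theorem smoothLag_update (S : Data p n q m) (X : ∀ i, Vec (n i)) (i : Fin p) (w : Vec (n i))
    (y : Vec q) (z : Vec m) : S.smoothLag (Function.update X i w) y z
      = S.h y + coupling (S.A i) (S.residual (Function.update X i 0) y) z S.α w := by
  rw [smoothLag, residual_update, coupling]; ring

theorem smoothLag_eq_coupling (S : Data p n q m) (X : ∀ i, Vec (n i)) (w : Vec q) (z : Vec m) :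
    S.smoothLag X w z = S.h w + coupling S.B (S.residual X 0) z S.α w := by
  rw [smoothLag, residual_eq_add, coupling]; ring

theorem augLag_eq (S : Data p n q m) (X : ∀ i, Vec (n i)) (y : Vec q) (z : Vec m) :
    S.augLag X y z = ∑ i, S.f i (X i) + (S.smoothLag X y z : EReal) := rfl

theorem sum_f_update (S : Data p n q m) (X : ∀ i, Vec (n i)) (i : Fin p) (w : Vec (n i)) :
    ∑ j, S.f j (Function.update X i w j)
      = S.f i w + ∑ j ∈ Finset.univ.erase i, S.f j (X j) := by
  rw [← Finset.add_sum_erase _ _ (Finset.mem_univ i), Function.update_self]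
  congr 1
  exact Finset.sum_congr rfl fun j hj => by rw [Function.update_of_ne (Finset.ne_of_mem_erase hj)]

/-- The minimal value is finite and no `fⱼ` takes the value `⊥`, so the sum over the other blocks is
a real number and cancels from the comparison. -/
theorem x_block_argmin (hS : S.Standing) {X : ∀ i, Vec (n i)} {i : Fin p} {a b : Vec (n i)}
    {y : Vec q} {z : Vec m}
    (h : IsArgmin (fun w : Vec (n i) => S.augLag (Function.update X i w) y z
      + ((1 / 2 * qform (S.Q i) (w - b) : ℝ) : EReal)) a) :
    S.f i a ≠ ⊤ ∧ ∀ w, S.f i a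
      + ((coupling (S.A i) (S.residual (Function.update X i 0) y) z S.α a
          + 1 / 2 * ⟪a - b, S.Q i (a - b)⟫_ℝ
        - (coupling (S.A i) (S.residual (Function.update X i 0) y) z S.α w
          + 1 / 2 * ⟪w - b, S.Q i (w - b)⟫_ℝ) : ℝ) : EReal) ≤ S.f i w := by
  set C := ∑ j ∈ Finset.univ.erase i, S.f j (X j) with hC
  have hCbot : C ≠ ⊥ := ereal_sum_ne_bot _ fun j _ => (hS.proper j).1 _
  have hsplit : ∀ w : Vec (n i), S.augLag (Function.update X i w) y z
      + ((1 / 2 * qform (S.Q i) (w - b) : ℝ) : EReal) = (S.f i w + C)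
      + ((S.h y + coupling (S.A i) (S.residual (Function.update X i 0) y) z S.α w
        + 1 / 2 * ⟪w - b, S.Q i (w - b)⟫_ℝ : ℝ) : EReal) := by
    intro w
    rw [augLag_eq, sum_f_update, smoothLag_update, EReal.coe_add (_ + _), ← add_assoc]
    rfl
  obtain ⟨hlt, hle⟩ := h
  simp only [hsplit] at hlt hle
  have hsum : S.f i a + C ≠ ⊤ := fun ht => by
    rw [ht, EReal.top_add_coe] at hlt
    exact lt_irrefl _ hlt
  have hfC := (EReal.add_ne_top_iff_ne_top₂ ((hS.proper i).1 a) hCbot).1 hsum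
  refine ⟨hfC.1, fun w => ?_⟩
  obtain ⟨C', hC'⟩ : ∃ C' : ℝ, C = C' := ⟨C.toReal, (EReal.coe_toReal hfC.2 hCbot).symm⟩
  have h1 := hle w
  rw [hC', add_assoc (S.f i a), add_assoc (S.f i w), ← EReal.coe_add, ← EReal.coe_add] at h1
  have h2 := ereal_add_coe_sub_le h1
  refine le_trans (le_of_eq ?_) h2
  congr 2
  ring

theorem y_block_argmin {X : ∀ i, Vec (n i)} {a b : Vec q} {z : Vec m}
    {F : Fin p → ℝ} (hF : ∀ i, S.f i (X i) = F i)
    (h : IsArgmin (fun w : Vec q => S.augLag X w z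
      + ((1 / 2 * qform S.P (w - b) : ℝ) : EReal)) a) (w : Vec q) :
    S.h a + coupling S.B (S.residual X 0) z S.α a + 1 / 2 * ⟪a - b, S.P (a - b)⟫_ℝ
      ≤ S.h w + coupling S.B (S.residual X 0) z S.α w + 1 / 2 * ⟪w - b, S.P (w - b)⟫_ℝ := by
  have h1 := h.2 w
  simp only [augLag_eq, hF, ← ereal_coe_sum, ← EReal.coe_add, EReal.coe_le_coe_iff,
    smoothLag_eq_coupling, qform] at h1
  linarith

/-- The point whose blocks before `t` are those of `u` and whose other blocks are those of `v`. -/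
def hybrid (u v : ∀ i, Vec (n i)) (t : ℕ) : ∀ i, Vec (n i) :=
  fun j => if (j : ℕ) < t then u j else v j

theorem hybrid_update_old (u v : ∀ i, Vec (n i)) (i : Fin p) :
    Function.update (fun j => if j < i then u j else v j) i (v i) = hybrid u v i := by
  funext j
  by_cases hj : j = i
  · subst hj; simp [hybrid]
  · simp [hybrid, Function.update_of_ne hj]

theorem hybrid_update_new (u v : ∀ i, Vec (n i)) (i : Fin p) :
    Function.update (fun j => if j < i then u j else v j) i (u i) = hybrid u v (i + 1) := by
  funext j
  by_cases hj : j = i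
  · subst hj; simp [hybrid]
  · have hj' : (j : ℕ) ≠ i := fun h => hj (Fin.ext h)
    have : (j : ℕ) < i + 1 ↔ (j : ℕ) < i := by omega
    simp [hybrid, Function.update_of_ne hj, this]

theorem hybrid_zero (u v : ∀ i, Vec (n i)) : hybrid u v 0 = v := by
  funext j; simp [hybrid]

theorem hybrid_card (u v : ∀ i, Vec (n i)) : hybrid u v p = u := by
  funext j; simp [hybrid]

/-! ### Sufficient decrease of the Lyapunov function -/

variable {x : ℕ → ∀ i, Vec (n i)} {y : ℕ → Vec q} {z : ℕ → Vec m} {τ : Fin p → ℝ}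

/-- The value of `fᵢ` at the `i`-th block of the `k`-th iterate. -/
noncomputable def fval (S : Data p n q m) (x : ℕ → ∀ i, Vec (n i)) (k : ℕ) (i : Fin p) : ℝ :=
  (S.f i (x k i)).toReal

theorem f_succ_eq_fval (hS : S.Standing) (hgen : S.IsGenerated x y z) (k : ℕ) (i : Fin p) :
    S.f i (x (k + 1) i) = S.fval x (k + 1) i :=
  (EReal.coe_toReal (x_block_argmin hS (hgen.x_step k i)).1 ((hS.proper i).1 _)).symm

/-- The comparison starts at index `k + 1`, since the initial point may have infinite `fᵢ`. -/
theorem x_block_decrease (hS : S.Standing) (h4 : S.A4 τ) (hgen : S.IsGenerated x y z) (k : ℕ)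
    (i : Fin p) :
    S.fval x (k + 2) i + S.smoothLag (hybrid (x (k + 2)) (x (k + 1)) (i + 1)) (y (k + 1)) (z (k + 1))
      + τ i / 2 * ‖x (k + 2) i - x (k + 1) i‖ ^ 2
      ≤ S.fval x (k + 1) i
        + S.smoothLag (hybrid (x (k + 2)) (x (k + 1)) i) (y (k + 1)) (z (k + 1)) := by
  have hmin := (x_block_argmin hS (hgen.x_step (k + 1) i)).2
  have ha := f_succ_eq_fval hS hgen (k + 1) i
  have hb := f_succ_eq_fval hS hgen k i
  rw [← hybrid_update_old, ← hybrid_update_new, smoothLag_update, smoothLag_update]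
  rcases h4 i with ⟨qi, -, hqi, rfl⟩ | ⟨ε, -, hε, hτ⟩
  · have := prox_min_decrease_of_coercive hmin ha hb hqi
    linarith
  · have hsymm : ((S.α • ((S.A i).adjoint ∘L S.A i) - ε • ContinuousLinearMap.id ℝ (Vec (n i)) :
        Vec (n i) →L[ℝ] Vec (n i)) : Vec (n i) →ₗ[ℝ] Vec (n i)).IsSymmetric := by
      intro u v
      simp [inner_sub_left, inner_sub_right, inner_smul_left, inner_smul_right,
        ContinuousLinearMap.adjoint_inner_left, ContinuousLinearMap.adjoint_inner_right]
    have := prox_min_decrease_of_weaklyConvex (τ := τ i) hS.α_pos (hS.Q_psd i) hmin ha hb hε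
      (fun w => by
        have h := lamMin_mul_sq_le hsymm w
        rw [← hτ] at h
        simpa [inner_sub_right, inner_smul_right, ContinuousLinearMap.adjoint_inner_right,
          real_inner_self_eq_norm_sq] using h)
    linarith

theorem x_step_decrease (hS : S.Standing) (h4 : S.A4 τ) (hgen : S.IsGenerated x y z) (k : ℕ) :
    ∑ i, S.fval x (k + 2) i + S.smoothLag (x (k + 2)) (y (k + 1)) (z (k + 1))
      + S.sigma τ / 2 * ∑ i, ‖x (k + 2) i - x (k + 1) i‖ ^ 2
      ≤ ∑ i, S.fval x (k + 1) i + S.smoothLag (x (k + 1)) (y (k + 1)) (z (k + 1)) := by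
  -- Along the hybrid points, block `i` moves the smooth part from `Φ i` to `Φ (i + 1)`, so the
  -- block decreases telescope.
  set Φ : ℕ → ℝ := fun t => S.smoothLag (hybrid (x (k + 2)) (x (k + 1)) t) (y (k + 1)) (z (k + 1))
    with hΦ
  have htel : ∑ i : Fin p, (Φ (i + 1) - Φ i) = S.smoothLag (x (k + 2)) (y (k + 1)) (z (k + 1))
      - S.smoothLag (x (k + 1)) (y (k + 1)) (z (k + 1)) := by
    rw [Fin.sum_univ_eq_sum_range (fun t => Φ (t + 1) - Φ t) p, Finset.sum_range_sub]
    simp only [hΦ, hybrid_zero, hybrid_card]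
  have hsum : ∑ i : Fin p, (Φ (i + 1) - Φ i) ≤ ∑ i, (S.fval x (k + 1) i - S.fval x (k + 2) i
      - S.sigma τ / 2 * ‖x (k + 2) i - x (k + 1) i‖ ^ 2) := by
    refine Finset.sum_le_sum fun i _ => ?_
    have h1 := x_block_decrease hS h4 hgen k i
    have h2 := mul_le_mul_of_nonneg_right (sigma_le_τ S τ i)
      (sq_nonneg ‖x (k + 2) i - x (k + 1) i‖)
    simp only [hΦ]
    linarith
  rw [htel] at hsum
  simp only [Finset.sum_sub_distrib, ← Finset.mul_sum] at hsum
  linarith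

theorem y_step_optimality (hS : S.Standing) (h2 : S.A2) (hgen : S.IsGenerated x y z) (k : ℕ) :
    gradient S.h (y (k + 1)) + S.B.adjoint (z k + S.α • S.residual (x (k + 1)) (y (k + 1)))
      + S.P (y (k + 1) - y k) = 0 := by
  rw [residual_eq_add]
  exact prox_min_gradient hS.α_pos hS.P_psd h2.2.1 h2.2.2
    (y_block_argmin (f_succ_eq_fval hS hgen k) (hgen.y_step k))

theorem y_step_decrease (hS : S.Standing) (h2 : S.A2) (hgen : S.IsGenerated x y z) (k : ℕ) :
    S.smoothLag (x (k + 1)) (y (k + 1)) (z k)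
      + (⟪y (k + 1) - y k, S.P (y (k + 1) - y k)⟫_ℝ + S.α / 2 * ‖S.B (y (k + 1) - y k)‖ ^ 2
        - S.Lh / 2 * ‖y (k + 1) - y k‖ ^ 2)
      ≤ S.smoothLag (x (k + 1)) (y k) (z k) := by
  rw [smoothLag_eq_coupling, smoothLag_eq_coupling]
  have h := y_step_optimality hS h2 hgen k
  rw [residual_eq_add] at h
  exact prox_min_decrease_of_lipschitz h2.2.1 h2.2.2 h

theorem residual_eq_smul (hS : S.Standing) (hgen : S.IsGenerated x y z) (k : ℕ) :
    S.residual (x (k + 1)) (y (k + 1)) = (1 / (S.α * S.β)) • (z (k + 1) - z k) := by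
  have := hS.α_pos
  have := hS.β_pos
  rw [hgen.z_step k, add_sub_cancel_left, smul_smul, one_div_mul_cancel (by positivity), one_smul]

theorem z_step_increase (hS : S.Standing) (hgen : S.IsGenerated x y z) (k : ℕ) :
    S.smoothLag (x (k + 1)) (y (k + 1)) (z (k + 1)) = S.smoothLag (x (k + 1)) (y (k + 1)) (z k)
      + 1 / (S.α * S.β) * ‖z (k + 1) - z k‖ ^ 2 := by
  have h : ⟪z (k + 1), S.residual (x (k + 1)) (y (k + 1))⟫_ℝ
      = ⟪z k, S.residual (x (k + 1)) (y (k + 1))⟫_ℝ + 1 / (S.α * S.β) * ‖z (k + 1) - z k‖ ^ 2 := by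
    rw [← sub_eq_iff_eq_add', ← inner_sub_left, residual_eq_smul hS hgen, inner_smul_right,
      real_inner_self_eq_norm_sq]
  rw [smoothLag, smoothLag, h]; ring

theorem dual_step_mem_range (h3 : S.A3) (hgen : S.IsGenerated x y z) (k : ℕ) :
    z (k + 1) - z k ∈ Set.range S.B := by
  obtain ⟨u, hu⟩ := h3.1 (x (k + 1))
  obtain ⟨v, hv⟩ := h3.2
  refine ⟨(S.α * S.β) • (u + y (k + 1) + v), ?_⟩
  rw [hgen.z_step k, add_sub_cancel_left, residual, map_smul, map_add, map_add, hu, hv]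

theorem adjoint_dual_step (hS : S.Standing) (h2 : S.A2) (hgen : S.IsGenerated x y z) (k : ℕ) :
    S.B.adjoint (z (k + 1)) = (1 - S.β) • S.B.adjoint (z k)
      - S.β • (gradient S.h (y (k + 1)) + S.P (y (k + 1) - y k)) := by
  have h := y_step_optimality hS h2 hgen k
  rw [map_add] at h
  have h' : S.B.adjoint (S.α • S.residual (x (k + 1)) (y (k + 1)))
      = -S.B.adjoint (z k) - (gradient S.h (y (k + 1)) + S.P (y (k + 1) - y k)) := by
    rw [eq_sub_iff_add_eq, ← sub_eq_zero, ← h]; abel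
  rw [hgen.z_step k, map_add, mul_comm, mul_smul, map_smul, h', sub_smul, one_smul, smul_sub,
    smul_neg]
  abel

/-- Subtracting two consecutive optimality conditions gives `BᵀΔz⁺ = (1 - β) BᵀΔz + β u`, with `u`
controlled by the last two `y`-steps. The relaxation estimate and the lower bound of `Bᵀ` on `Im B`
then give the claim. -/
theorem dual_step_norm_sq_le (hS : S.Standing) (h2 : S.A2) (h3 : S.A3)
    (hgen : S.IsGenerated x y z) (k : ℕ) :
    1 / (S.α * S.β) * ‖z (k + 2) - z (k + 1)‖ ^ 2
      ≤ S.c5 * (‖S.B.adjoint (z (k + 1) - z k)‖ ^ 2 - ‖S.B.adjoint (z (k + 2) - z (k + 1))‖ ^ 2)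
        + S.c4 * ‖y (k + 2) - y (k + 1)‖ ^ 2 + S.c3 * ‖y (k + 1) - y k‖ ^ 2 := by
  have hα := hS.α_pos
  have hβ := hS.β_pos
  have hρ := rho_pos hS
  have hlamB := lamB_pos hS
  set u : Vec q := -((gradient S.h (y (k + 2)) - gradient S.h (y (k + 1)))
    + S.P (y (k + 2) - y (k + 1)) - S.P (y (k + 1) - y k)) with hu
  have hrec : S.B.adjoint (z (k + 2) - z (k + 1))
      = (1 - S.β) • S.B.adjoint (z (k + 1) - z k) + S.β • u := by
    rw [map_sub, map_sub]
    have e1 := adjoint_dual_step hS h2 hgen (k + 1)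
    have e2 := adjoint_dual_step hS h2 hgen k
    rw [add_assoc, one_add_one_eq_two] at e1
    nth_rewrite 1 [e1]
    nth_rewrite 2 [e2]
    rw [hu]
    module
  have hrel := norm_sq_relaxation_le hβ hS.β_lt_two (S.B.adjoint (z (k + 1) - z k)) u
  rw [← hrec] at hrel
  have hlam := (lamPos_gram hS.B_ne_zero).2 _ (dual_step_mem_range h3 hgen (k + 1))
  rw [add_assoc, one_add_one_eq_two] at hlam
  have hu1 : ‖u‖ ≤ (‖S.P‖ + S.Lh) * ‖y (k + 2) - y (k + 1)‖ + ‖S.P‖ * ‖y (k + 1) - y k‖ := by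
    rw [hu, norm_neg]
    have a1 := h2.2.2 (y (k + 1)) (y (k + 2))
    have a2 := S.P.le_opNorm (y (k + 2) - y (k + 1))
    have a3 := S.P.le_opNorm (y (k + 1) - y k)
    refine (norm_sub_le _ _).trans ?_
    have a4 := norm_add_le (gradient S.h (y (k + 2)) - gradient S.h (y (k + 1)))
      (S.P (y (k + 2) - y (k + 1)))
    linarith
  have hu2 : ‖u‖ ^ 2 ≤ 2 * ((‖S.P‖ + S.Lh) ^ 2 * ‖y (k + 2) - y (k + 1)‖ ^ 2
      + ‖S.P‖ ^ 2 * ‖y (k + 1) - y k‖ ^ 2) := by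
    have := pow_le_pow_left₀ (norm_nonneg u) hu1 2
    nlinarith [sq_nonneg ((‖S.P‖ + S.Lh) * ‖y (k + 2) - y (k + 1)‖ - ‖S.P‖ * ‖y (k + 1) - y k‖)]
  have hs : |1 - S.β| = 1 - S.rho := by unfold rho; ring
  change _ ≤ _ + S.β ^ 2 / S.rho * _ at hrel
  change S.lamB * _ ≤ _ at hlam
  simp only [c5, c4, c3, c2, c1]
  rw [hs] at hrel ⊢
  set Z := ‖z (k + 2) - z (k + 1)‖ ^ 2
  set D₁ := ‖S.B.adjoint (z (k + 2) - z (k + 1))‖ ^ 2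
  set D₀ := ‖S.B.adjoint (z (k + 1) - z k)‖ ^ 2
  set Y₁ := (‖S.P‖ + S.Lh) ^ 2 * ‖y (k + 2) - y (k + 1)‖ ^ 2
  set Y₀ := ‖S.P‖ ^ 2 * ‖y (k + 1) - y k‖ ^ 2
  -- Moving `(1 - ρ) D₁` to the right leaves `ρ D₁ ≥ ρ λ₊₊ Z` on the left; dividing by `αβρλ₊₊`
  -- produces `c₂` and `c₅`.
  have hkey : S.rho * S.lamB * Z ≤ (1 - S.rho) * (D₀ - D₁)
      + S.β ^ 2 / S.rho * (2 * (Y₁ + Y₀)) := by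
    have b1 := mul_le_mul_of_nonneg_left hlam hρ.le
    have b2 := mul_le_mul_of_nonneg_left hu2 (show 0 ≤ S.β ^ 2 / S.rho by positivity)
    linarith
  have hpos : 0 < S.α * S.β * S.rho * S.lamB := by positivity
  have hdiv := div_le_div_of_nonneg_right hkey hpos.le
  refine (le_of_eq ?_).trans (hdiv.trans (le_of_eq ?_))
  · field_simp
  · simp only [Y₁, Y₀]
    field_simp
    ring

/-- The real value of the Lyapunov function at the `k`-th iterate. -/
noncomputable def lyapVal (S : Data p n q m) (x : ℕ → ∀ i, Vec (n i)) (y : ℕ → Vec q)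
    (z : ℕ → Vec m) (k : ℕ) : ℝ :=
  ∑ i, S.fval x k i + (S.smoothLag (x k) (y k) (z k)
    + S.lyapTail (y k) (z k) (y (k - 1)) (z (k - 1)))

theorem LbarSeq_succ (hS : S.Standing) (hgen : S.IsGenerated x y z) (k : ℕ) :
    S.LbarSeq x y z (k + 1) = (S.lyapVal x y z (k + 1) : EReal) :=
  S.Lbar_eq_coe (f_succ_eq_fval hS hgen k) _ _ _ _

/-- The squared length of the step that leads to the `k`-th iterate. -/
noncomputable def stepSq (x : ℕ → ∀ i, Vec (n i)) (y : ℕ → Vec q) (z : ℕ → Vec m) (k : ℕ) : ℝ :=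
  ∑ i, ‖x k i - x (k - 1) i‖ ^ 2 + ‖y k - y (k - 1)‖ ^ 2 + ‖z k - z (k - 1)‖ ^ 2

theorem stepSq_nonneg (x : ℕ → ∀ i, Vec (n i)) (y : ℕ → Vec q) (z : ℕ → Vec m) (k : ℕ) :
    0 ≤ stepSq x y z k := by
  have : 0 ≤ ∑ i, ‖x k i - x (k - 1) i‖ ^ 2 := Finset.sum_nonneg fun i _ => by positivity
  unfold stepSq
  positivity

theorem lyapVal_decrease (hS : S.Standing) (h2 : S.A2) (h3 : S.A3) (h4 : S.A4 τ)
    (hgen : S.IsGenerated x y z) (hσ : 0 < S.sigma τ) (k : ℕ) :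
    S.sigma τ / 2 * stepSq x y z (k + 2) ≤ S.lyapVal x y z (k + 1) - S.lyapVal x y z (k + 2) := by
  have hε := hS.one_lt_ε₀
  have e1 := x_step_decrease hS h4 hgen k
  have e2 := y_step_decrease hS h2 hgen (k + 1)
  have e3 := z_step_increase hS hgen (k + 1)
  -- The dual estimate is multiplied by `ε₀`, not by `1`: one copy cancels the increase of the
  -- multiplier step, and the remaining `ε₀ - 1` gives the decrease in `‖Δz‖²`.
  have e4 := mul_le_mul_of_nonneg_left (dual_step_norm_sq_le hS h2 h3 hgen k)
    (show 0 ≤ S.ε₀ by linarith)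
  have e5 := sigma_mul_norm_sq_le hS τ (y (k + 2) - y (k + 1))
  have e6 : S.sigma τ * ‖z (k + 2) - z (k + 1)‖ ^ 2
      ≤ (S.ε₀ - 1) / (S.α * S.β) * ‖z (k + 2) - z (k + 1)‖ ^ 2 :=
    mul_le_mul_of_nonneg_right ((min_le_right _ _).trans (min_le_right _ _)) (sq_nonneg _)
  have e7 : 0 ≤ S.sigma τ * ‖z (k + 2) - z (k + 1)‖ ^ 2 := by positivity
  rw [sub_div, div_eq_mul_one_div S.ε₀] at e6
  unfold lyapVal lyapTail stepSq
  simp only [Nat.add_sub_cancel, show k + 2 - 1 = k + 1 by omega] at *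
  linarith

end Data

namespace Data

variable {p : ℕ} {n : Fin p → ℕ} {q m : ℕ} {S : Data p n q m}
  {x : ℕ → ∀ i, Vec (n i)} {y : ℕ → Vec q} {z : ℕ → Vec m} {τ : Fin p → ℝ}

/-! ### Relative error bound for the subgradients -/

theorem norm_hybrid_residual_sub_le (S : Data p n q m) (u v : ∀ i, Vec (n i)) (y y' : Vec q)
    (t : ℕ) {X Y : ℝ} (hX : ∀ i, ‖u i - v i‖ ≤ X) (hY : ‖y' - y‖ ≤ Y) :
    ‖S.residual u y' - S.residual (hybrid u v t) y‖ ≤ (∑ i, ‖S.A i‖) * X + ‖S.B‖ * Y := by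
  rw [residual_sub, Finset.sum_mul]
  refine (norm_add_le _ _).trans (add_le_add ((norm_sum_le _ _).trans
    (Finset.sum_le_sum fun i _ => (S.A i).le_of_opNorm_le_of_le le_rfl ?_))
    (S.B.le_of_opNorm_le_of_le le_rfl hY))
  unfold hybrid
  split_ifs
  · rw [sub_self, norm_zero]; exact (norm_nonneg _).trans (hX i)
  · exact hX i

theorem rhoTilde_pos (hS : S.Standing) : 0 < S.rhoTilde := by
  have hα := hS.α_pos
  have hβ := hS.β_pos
  have h5 := ε₀_mul_c5_nonneg hS
  have ha : 0 ≤ ∑ i, ‖S.A i‖ := Finset.sum_nonneg fun i _ => norm_nonneg _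
  have h1 : 0 < 1 / (S.α * S.β) := by positivity
  have h2 : 0 ≤ S.ε₀ * S.c5 * ‖S.B‖ ^ 2 := by positivity
  have h3 := norm_nonneg S.B
  refine lt_of_lt_of_le ?_ ((le_max_right _ _).trans (le_max_right _ _))
  linarith

theorem norm_adjoint_apply_le {d r : ℕ} (T : Vec d →L[ℝ] Vec r) (v : Vec r) :
    ‖T.adjoint v‖ ≤ ‖T‖ * ‖v‖ := by
  have h := T.adjoint.le_opNorm v
  rwa [LinearIsometryEquiv.norm_map] at h

theorem exists_subgradient_norm_le (hS : S.Standing) (h2 : S.A2) (hgen : S.IsGenerated x y z)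
    (k : ℕ) {X : ℝ} (hX : ∀ i, ‖x (k + 1) i - x k i‖ ≤ X) :
    ∃ s ∈ limSubdiff S.Lbar (lyapPoint (x (k + 1)) (y (k + 1)) (z (k + 1)) (y k) (z k)),
      ‖s‖ ≤ ((∑ i, ‖S.Q i‖) + S.α * (∑ i, ‖S.A i‖) ^ 2) * X
        + (‖S.P‖ + S.α * (∑ i, ‖S.A i‖) * ‖S.B‖ + 4 * S.ε₀ * S.c3) * ‖y (k + 1) - y k‖
        + ((∑ i, ‖S.A i‖) + ‖S.B‖ + 4 * S.ε₀ * S.c5 * ‖S.B‖ ^ 2 + 1 / (S.α * S.β))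
          * ‖z (k + 1) - z k‖ := by
  have hα := hS.α_pos
  have hβ := hS.β_pos
  have h3 := ε₀_mul_c3_nonneg hS
  have h5 := ε₀_mul_c5_nonneg hS
  have hmin := fun i => (x_block_argmin hS (hgen.x_step k i)).2
  have hs := fun i w => quadratic_minorant_of_prox_min hα (hS.Q_psd i) (hmin i) w
  have hmem := S.lyapPoint_mem_limSubdiff_Lbar hα h2 h3 h5 (f_succ_eq_fval hS hgen k) hs
    (y (k + 1)) (y k) (z (k + 1)) (z k)
  refine ⟨_, hmem, (norm_lyapPoint_le _ _ _ _ _).trans ?_⟩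
  simp only [← residual_update, hybrid_update_new]
  set r := S.residual (x (k + 1)) (y (k + 1)) with hr
  set Y := ‖y (k + 1) - y k‖ with hY
  set Z := ‖z (k + 1) - z k‖ with hZ
  set a := ∑ i, ‖S.A i‖ with ha
  have hx : ∀ i, ‖-((S.A i).adjoint (z k + S.α • S.residual (hybrid (x (k + 1)) (x k) (i + 1)) (y k))
      + S.Q i (x (k + 1) i - x k i)) + (S.A i).adjoint (z (k + 1) + S.α • r)‖
      ≤ ‖S.A i‖ * (Z + S.α * (a * X + ‖S.B‖ * Y)) + ‖S.Q i‖ * X := by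
    intro i
    -- The block optimality condition holds at the hybrid point with the old `y` and `z`;
    -- subtracting it from the gradient at the new point leaves only increments.
    have e : -((S.A i).adjoint (z k + S.α • S.residual (hybrid (x (k + 1)) (x k) (i + 1)) (y k))
      + S.Q i (x (k + 1) i - x k i)) + (S.A i).adjoint (z (k + 1) + S.α • r)
      = (S.A i).adjoint ((z (k + 1) - z k)
        + S.α • (r - S.residual (hybrid (x (k + 1)) (x k) (i + 1)) (y k)))
        - S.Q i (x (k + 1) i - x k i) := by
      simp only [map_add, map_sub, map_smul, smul_sub]; abel
    rw [e]
    refine (norm_sub_le _ _).trans (add_le_add ((norm_adjoint_apply_le _ _).trans ?_)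
      ((S.Q i).le_of_opNorm_le_of_le le_rfl (hX i)))
    refine mul_le_mul_of_nonneg_left ((norm_add_le _ _).trans ?_) (norm_nonneg _)
    rw [norm_smul, Real.norm_eq_abs, abs_of_pos hα]
    gcongr
    exact S.norm_hybrid_residual_sub_le _ _ _ _ _ hX le_rfl
  have hxs : ∑ i, ‖-((S.A i).adjoint
      (z k + S.α • S.residual (hybrid (x (k + 1)) (x k) (i + 1)) (y k))
      + S.Q i (x (k + 1) i - x k i)) + (S.A i).adjoint (z (k + 1) + S.α • r)‖
      ≤ a * (Z + S.α * (a * X + ‖S.B‖ * Y)) + (∑ i, ‖S.Q i‖) * X := by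
    refine (Finset.sum_le_sum fun i _ => hx i).trans (le_of_eq ?_)
    rw [Finset.sum_add_distrib, ← Finset.sum_mul, ← Finset.sum_mul]
  have h3Y : ‖(2 * (S.ε₀ * S.c3)) • (y (k + 1) - y k)‖ = 2 * (S.ε₀ * S.c3) * Y := by
    rw [norm_smul, Real.norm_eq_abs, abs_of_nonneg (by positivity)]
  have h5Z : ‖(2 * (S.ε₀ * S.c5)) • S.B (S.B.adjoint (z (k + 1) - z k))‖
      ≤ 2 * (S.ε₀ * S.c5) * (‖S.B‖ ^ 2 * Z) := by
    rw [norm_smul, Real.norm_eq_abs, abs_of_nonneg (by positivity), sq, mul_assoc ‖S.B‖]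
    gcongr
    exact S.B.le_of_opNorm_le_of_le le_rfl (norm_adjoint_apply_le _ _)
  have hys : ‖gradient S.h (y (k + 1)) + S.B.adjoint (z (k + 1) + S.α • r)
      + (2 * (S.ε₀ * S.c3)) • (y (k + 1) - y k)‖
      ≤ ‖S.B‖ * Z + ‖S.P‖ * Y + 2 * (S.ε₀ * S.c3) * Y := by
    have e : gradient S.h (y (k + 1)) + S.B.adjoint (z (k + 1) + S.α • r)
        = S.B.adjoint (z (k + 1) - z k) - S.P (y (k + 1) - y k) := by
      have h := y_step_optimality hS h2 hgen k
      rw [← hr] at h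
      rw [← sub_eq_zero, ← h]
      simp only [map_add, map_sub]; abel
    rw [e, ← h3Y]
    refine (norm_add_le _ _).trans (add_le_add ((norm_sub_le _ _).trans (add_le_add ?_ ?_)) le_rfl)
    · exact norm_adjoint_apply_le _ _
    · exact S.P.le_opNorm _
  have hzs : ‖r + (2 * (S.ε₀ * S.c5)) • S.B (S.B.adjoint (z (k + 1) - z k))‖
      ≤ 1 / (S.α * S.β) * Z + 2 * (S.ε₀ * S.c5) * (‖S.B‖ ^ 2 * Z) := by
    refine (norm_add_le _ _).trans (add_le_add (le_of_eq ?_) h5Z)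
    rw [hr, residual_eq_smul hS hgen, norm_smul, Real.norm_eq_abs, abs_of_pos (by positivity)]
  rw [norm_neg, norm_neg, h3Y]
  linarith

theorem norm_x_step_sq_le (x : ℕ → ∀ i, Vec (n i)) (k : ℕ) (i : Fin p) :
    ‖x k i - x (k - 1) i‖ ^ 2 ≤ ∑ i, ‖x k i - x (k - 1) i‖ ^ 2 :=
  Finset.single_le_sum (f := fun i => ‖x k i - x (k - 1) i‖ ^ 2) (fun _ _ => by positivity)
    (Finset.mem_univ i)

theorem exists_subgradient_le_stepSq (hp : 1 ≤ p) (hS : S.Standing) (h2 : S.A2)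
    (hgen : S.IsGenerated x y z) (k : ℕ) :
    ∃ s ∈ limSubdiff S.Lbar (lyapPoint (x (k + 1)) (y (k + 1)) (z (k + 1)) (y k) (z k)),
      ‖s‖ ≤ S.rhoTilde * (√((p : ℝ) + 2) * √(stepSq x y z (k + 1))) := by
  have hsum : 0 ≤ ∑ i, ‖x (k + 1) i - x k i‖ ^ 2 := Finset.sum_nonneg fun i _ => by positivity
  set X := √(∑ i, ‖x (k + 1) i - x k i‖ ^ 2) with hX
  have hX2 : X ^ 2 = ∑ i, ‖x (k + 1) i - x k i‖ ^ 2 := Real.sq_sqrt hsum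
  have hXi : ∀ i, ‖x (k + 1) i - x k i‖ ≤ X := fun i =>
    Real.le_sqrt_of_sq_le (norm_x_step_sq_le x (k + 1) i)
  obtain ⟨s, hs, hle⟩ := exists_subgradient_norm_le hS h2 hgen k hXi
  refine ⟨s, hs, hle.trans ?_⟩
  have hX0 : 0 ≤ X := Real.sqrt_nonneg _
  have hY0 := norm_nonneg (y (k + 1) - y k)
  have hZ0 := norm_nonneg (z (k + 1) - z k)
  have h1 : (∑ i, ‖S.Q i‖) + S.α * (∑ i, ‖S.A i‖) ^ 2 ≤ S.rhoTilde := le_max_left _ _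
  have h2' : ‖S.P‖ + S.α * (∑ i, ‖S.A i‖) * ‖S.B‖ + 4 * S.ε₀ * S.c3 ≤ S.rhoTilde :=
    (le_max_left _ _).trans (le_max_right _ _)
  have h3 : (∑ i, ‖S.A i‖) + ‖S.B‖ + 4 * S.ε₀ * S.c5 * ‖S.B‖ ^ 2 + 1 / (S.α * S.β) ≤ S.rhoTilde :=
    (le_max_right _ _).trans (le_max_right _ _)
  have h4 : X + ‖y (k + 1) - y k‖ + ‖z (k + 1) - z k‖
      ≤ √((p : ℝ) + 2) * √(stepSq x y z (k + 1)) := by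
    rw [← Real.sqrt_mul (by positivity)]
    refine Real.le_sqrt_of_sq_le ?_
    have hp' : (1 : ℝ) ≤ p := by exact_mod_cast hp
    have hst : stepSq x y z (k + 1)
        = X ^ 2 + ‖y (k + 1) - y k‖ ^ 2 + ‖z (k + 1) - z k‖ ^ 2 := by
      rw [hX2]; rfl
    have h0 := stepSq_nonneg x y z (k + 1)
    -- Cauchy–Schwarz on three terms needs only the factor `3`, since `X` is already the Euclidean
    -- norm of the whole `x`-step; `p ≥ 1` gives `3 ≤ p + 2`.
    have : 3 * stepSq x y z (k + 1) ≤ ((p : ℝ) + 2) * stepSq x y z (k + 1) := by gcongr; linarith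
    refine le_trans ?_ this
    rw [hst]
    nlinarith [sq_nonneg (X - ‖y (k + 1) - y k‖), sq_nonneg (X - ‖z (k + 1) - z k‖),
      sq_nonneg (‖y (k + 1) - y k‖ - ‖z (k + 1) - z k‖)]
  have h5 := mul_le_mul_of_nonneg_left h4 (rhoTilde_pos hS).le
  have h6 := mul_le_mul_of_nonneg_right h1 hX0
  have h7 := mul_le_mul_of_nonneg_right h2' hY0
  have h8 := mul_le_mul_of_nonneg_right h3 hZ0
  linarith

/-! ### Convergence of the Lyapunov values to the value at a limit point -/

theorem continuous_smoothLag (h2 : S.A2) :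
    Continuous fun t : (∀ i, Vec (n i)) × Vec q × Vec m => S.smoothLag t.1 t.2.1 t.2.2 := by
  have := h2.2.1.continuous
  unfold smoothLag residual
  fun_prop

theorem lyapTail_nonneg (hS : S.Standing) (y₁ y₂ : Vec q) (z₁ z₂ : Vec m) :
    0 ≤ S.lyapTail y₁ z₁ y₂ z₂ := by
  have := ε₀_mul_c3_nonneg hS
  have := ε₀_mul_c5_nonneg hS
  unfold lyapTail
  positivity

theorem lyapVal_antitone (hS : S.Standing) (h2 : S.A2) (h3 : S.A3) (h4 : S.A4 τ)
    (hgen : S.IsGenerated x y z) (hσ : 0 < S.sigma τ) :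
    Antitone fun k => S.lyapVal x y z (k + 1) :=
  antitone_nat_of_succ_le fun k => by
    have h := lyapVal_decrease hS h2 h3 h4 hgen hσ k
    have := stepSq_nonneg x y z (k + 2)
    have : 0 ≤ S.sigma τ / 2 * stepSq x y z (k + 2) := by positivity
    linarith

section LimitPoint

variable {xs : ∀ i, Vec (n i)} {ys : Vec q} {zs : Vec m} {F : Fin p → ℝ} {ψ : ℕ → ℕ}

theorem eventually_lt_fval (hS : S.Standing) (h1 : S.A1) (hgen : S.IsGenerated x y z)
    (hx : Tendsto (fun j => x (ψ j + 1)) atTop (𝓝 xs)) (hF : ∀ i, S.f i (xs i) = F i) (i : Fin p)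
    {t : ℝ} (ht : t < F i) : ∀ᶠ j in atTop, t < S.fval x (ψ j + 1) i := by
  have hlsc := (h1 i).1 (xs i) t (show (t : EReal) < S.f i (xs i) by rw [hF]; exact_mod_cast ht)
  filter_upwards [(tendsto_pi_nhds.1 hx i).eventually hlsc] with j hj
  rw [f_succ_eq_fval hS hgen] at hj
  exact_mod_cast hj

theorem tendsto_smoothLag (h2 : S.A2) {u : ℕ → ∀ i, Vec (n i)} {v : ℕ → Vec q} {w : ℕ → Vec m}
    (hu : Tendsto u atTop (𝓝 xs)) (hv : Tendsto v atTop (𝓝 ys)) (hw : Tendsto w atTop (𝓝 zs)) :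
    Tendsto (fun j => S.smoothLag (u j) (v j) (w j)) atTop (𝓝 (S.smoothLag xs ys zs)) :=
  ((continuous_smoothLag h2).tendsto (xs, ys, zs)).comp
    (hu.prodMk_nhds (hv.prodMk_nhds hw))

/-- Only values along the subsequence are bounded below, by lower semicontinuity; monotonicity
passes the bound to every index, as a later index of the subsequence always exists. -/
theorem exists_lyapVal_lower_bound (hS : S.Standing) (h1 : S.A1) (h2 : S.A2) (h3 : S.A3)
    (h4 : S.A4 τ) (hgen : S.IsGenerated x y z) (hσ : 0 < S.sigma τ) (hψ : StrictMono ψ)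
    (hx : Tendsto (fun j => x (ψ j + 1)) atTop (𝓝 xs))
    (hy : Tendsto (fun j => y (ψ j + 1)) atTop (𝓝 ys))
    (hz : Tendsto (fun j => z (ψ j + 1)) atTop (𝓝 zs)) (hF : ∀ i, S.f i (xs i) = F i) :
    ∃ c, ∀ k, c ≤ S.lyapVal x y z (k + 1) := by
  refine ⟨∑ i, (F i - 1) + (S.smoothLag xs ys zs - 1), fun k => ?_⟩
  have hf : ∀ᶠ j in atTop, ∀ i, F i - 1 < S.fval x (ψ j + 1) i :=
    eventually_all.2 fun i => eventually_lt_fval hS h1 hgen hx hF i (by linarith)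
  have hl := (tendsto_smoothLag h2 hx hy hz).eventually (lt_mem_nhds (sub_one_lt _))
  obtain ⟨j, hfj, hlj, hkj⟩ := (hf.and (hl.and (eventually_ge_atTop k))).exists
  refine le_trans ?_ (lyapVal_antitone hS h2 h3 h4 hgen hσ (hkj.trans (hψ.id_le j)))
  have a1 : ∑ i, (F i - 1) ≤ ∑ i, S.fval x (ψ j + 1) i := Finset.sum_le_sum fun i _ => (hfj i).le
  have a2 := lyapTail_nonneg hS (y (ψ j + 1)) (y (ψ j + 1 - 1)) (z (ψ j + 1)) (z (ψ j + 1 - 1))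
  simp only [lyapVal]
  linarith

theorem tendsto_stepSq (hS : S.Standing) (h2 : S.A2) (h3 : S.A3)
    (h4 : S.A4 τ) (hgen : S.IsGenerated x y z) (hσ : 0 < S.sigma τ)
    {ℓ : ℝ} (hℓ : Tendsto (fun k => S.lyapVal x y z (k + 1)) atTop (𝓝 ℓ)) :
    Tendsto (stepSq x y z) atTop (𝓝 0) := by
  rw [← tendsto_add_atTop_iff_nat 2]
  have hdiff : Tendsto (fun k => (S.lyapVal x y z (k + 1) - S.lyapVal x y z (k + 2))
      / (S.sigma τ / 2)) atTop (𝓝 0) := by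
    have h := (hℓ.sub (hℓ.comp (tendsto_add_atTop_nat 1))).div_const (S.sigma τ / 2)
    rw [sub_self, zero_div] at h
    exact h
  refine squeeze_zero (fun k => stepSq_nonneg x y z _) (fun k => ?_) hdiff
  rw [le_div_iff₀ (by positivity)]
  have := lyapVal_decrease hS h2 h3 h4 hgen hσ k
  linarith

theorem tendsto_previous {E : Type*} [NormedAddCommGroup E] {w : ℕ → E} {ws : E} {s : ℕ → ℝ}
    (hs : Tendsto s atTop (𝓝 0)) (hws : ∀ k, ‖w (k + 1) - w k‖ ^ 2 ≤ s (k + 1))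
    (hψ : StrictMono ψ) (hw : Tendsto (fun j => w (ψ j + 1)) atTop (𝓝 ws)) :
    Tendsto (fun j => w (ψ j)) atTop (𝓝 ws) := by
  have h0 : Tendsto (fun j => w (ψ j + 1) - w (ψ j)) atTop (𝓝 0) := by
    have h1 : Tendsto (fun j => √(s (ψ j + 1))) atTop (𝓝 0) := by
      have := (hs.comp ((tendsto_add_atTop_nat 1).comp hψ.tendsto_atTop)).sqrt
      rwa [Real.sqrt_zero] at this
    exact squeeze_zero_norm (fun j => Real.le_sqrt_of_sq_le (hws (ψ j))) h1
  have := hw.sub h0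
  simpa using this

/-- Lower semicontinuity gives the lower estimate. For the upper one, `xs i` is a competitor in the
argmin that produced the new block: all other terms are continuous, and they cancel in the limit
because old and new iterates share the limit. -/
theorem tendsto_fval (hS : S.Standing) (h1 : S.A1) (h2 : S.A2) (hgen : S.IsGenerated x y z)
    (hx : Tendsto (fun j => x (ψ j + 1)) atTop (𝓝 xs))
    (hx' : Tendsto (fun j => x (ψ j)) atTop (𝓝 xs))
    (hy' : Tendsto (fun j => y (ψ j)) atTop (𝓝 ys))
    (hz' : Tendsto (fun j => z (ψ j)) atTop (𝓝 zs)) (hF : ∀ i, S.f i (xs i) = F i) (i : Fin p) :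
    Tendsto (fun j => S.fval x (ψ j + 1) i) atTop (𝓝 (F i)) := by
  set X : ℕ → ∀ i, Vec (n i) := fun j l => if l < i then x (ψ j + 1) l else x (ψ j) l with hXdef
  have hX : Tendsto X atTop (𝓝 xs) := by
    refine tendsto_pi_nhds.2 fun l => ?_
    simp only [hXdef]
    split_ifs
    · exact tendsto_pi_nhds.1 hx l
    · exact tendsto_pi_nhds.1 hx' l
  have hxi := tendsto_pi_nhds.1 hx i
  have hxi' := tendsto_pi_nhds.1 hx' i
  set G : ℕ → ℝ := fun j =>
    F i + ((S.smoothLag (Function.update (X j) i (xs i)) (y (ψ j)) (z (ψ j))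
        + 1 / 2 * ⟪xs i - x (ψ j) i, S.Q i (xs i - x (ψ j) i)⟫_ℝ)
      - (S.smoothLag (Function.update (X j) i (x (ψ j + 1) i)) (y (ψ j)) (z (ψ j))
        + 1 / 2 * ⟪x (ψ j + 1) i - x (ψ j) i, S.Q i (x (ψ j + 1) i - x (ψ j) i)⟫_ℝ)) with hG
  have hquad : ∀ {w : ℕ → Vec (n i)}, Tendsto w atTop (𝓝 (xs i)) →
      Tendsto (fun j => 1 / 2 * ⟪w j - x (ψ j) i, S.Q i (w j - x (ψ j) i)⟫_ℝ) atTop (𝓝 0) := by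
    intro w hw
    have hd := hw.sub hxi'
    rw [sub_self] at hd
    have := (hd.inner (((S.Q i).continuous.tendsto _).comp hd)).const_mul (1 / 2 : ℝ)
    simpa using this
  have hGlim : Tendsto G atTop (𝓝 (F i)) := by
    have l1 := tendsto_smoothLag h2 (hX.update i (tendsto_const_nhds (x := xs i))) hy' hz'
    have l2 := tendsto_smoothLag h2 (hX.update i hxi) hy' hz'
    have := ((l1.add (hquad tendsto_const_nhds)).sub (l2.add (hquad hxi))).const_add (F i)
    rw [sub_self, add_zero] at this
    exact this
  have hle : ∀ j, S.fval x (ψ j + 1) i ≤ G j := by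
    intro j
    have h := (x_block_argmin hS (hgen.x_step (ψ j) i)).2 (xs i)
    rw [hF, f_succ_eq_fval hS hgen, ← EReal.coe_add, EReal.coe_le_coe_iff] at h
    simp only [hG, smoothLag_update, hXdef]
    linarith
  refine tendsto_order.2 ⟨fun t ht => eventually_lt_fval hS h1 hgen hx hF i ht, fun t ht => ?_⟩
  filter_upwards [hGlim.eventually (gt_mem_nhds ht)] with j hj
  exact (hle j).trans_lt hj

theorem tendsto_lyapVal (hS : S.Standing) (h1 : S.A1) (h2 : S.A2) (h3 : S.A3)
    (h4 : S.A4 τ) (hgen : S.IsGenerated x y z) (hσ : 0 < S.sigma τ) (hψ : StrictMono ψ)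
    (hx : Tendsto (fun j => x (ψ j + 1)) atTop (𝓝 xs))
    (hy : Tendsto (fun j => y (ψ j + 1)) atTop (𝓝 ys))
    (hz : Tendsto (fun j => z (ψ j + 1)) atTop (𝓝 zs)) (hF : ∀ i, S.f i (xs i) = F i) :
    Tendsto (fun k => S.lyapVal x y z (k + 1)) atTop
      (𝓝 (∑ i, F i + (S.smoothLag xs ys zs + S.lyapTail ys zs ys zs))) ∧
    Tendsto (stepSq x y z) atTop (𝓝 0) := by
  obtain ⟨c, hc⟩ := exists_lyapVal_lower_bound hS h1 h2 h3 h4 hgen hσ hψ hx hy hz hF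
  have hℓ := tendsto_atTop_ciInf (lyapVal_antitone hS h2 h3 h4 hgen hσ)
    ⟨c, by rintro _ ⟨k, rfl⟩; exact hc k⟩
  have hstep := tendsto_stepSq hS h2 h3 h4 hgen hσ hℓ
  have hsum0 : ∀ k, 0 ≤ ∑ i, ‖x (k + 1) i - x k i‖ ^ 2 := fun k =>
    Finset.sum_nonneg fun i _ => by positivity
  have hx' : Tendsto (fun j => x (ψ j)) atTop (𝓝 xs) := tendsto_pi_nhds.2 fun i =>
    tendsto_previous (w := fun k => x k i) hstep (fun k => by
      have := norm_x_step_sq_le x (k + 1) i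
      have := sq_nonneg ‖y (k + 1) - y k‖
      have := sq_nonneg ‖z (k + 1) - z k‖
      simp only [stepSq, Nat.add_sub_cancel] at *
      linarith) hψ (tendsto_pi_nhds.1 hx i)
  have hy' : Tendsto (fun j => y (ψ j)) atTop (𝓝 ys) :=
    tendsto_previous hstep (fun k => by
      have := hsum0 k
      have := sq_nonneg ‖z (k + 1) - z k‖
      simp only [stepSq, Nat.add_sub_cancel]
      linarith) hψ hy
  have hz' : Tendsto (fun j => z (ψ j)) atTop (𝓝 zs) :=
    tendsto_previous hstep (fun k => by
      have := hsum0 k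
      have := sq_nonneg ‖y (k + 1) - y k‖
      simp only [stepSq, Nat.add_sub_cancel]
      linarith) hψ hz
  have htail : Tendsto (fun j => S.lyapTail (y (ψ j + 1)) (z (ψ j + 1)) (y (ψ j)) (z (ψ j))) atTop
      (𝓝 (S.lyapTail ys zs ys zs)) := by
    have a1 := (((S.B.adjoint.continuous.tendsto _).comp (hz.sub hz')).norm.pow 2).const_mul
      (S.ε₀ * S.c5)
    exact a1.add (((hy.sub hy').norm.pow 2).const_mul (S.ε₀ * S.c3))
  have hsub : Tendsto (fun j => S.lyapVal x y z (ψ j + 1)) atTop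
      (𝓝 (∑ i, F i + (S.smoothLag xs ys zs + S.lyapTail ys zs ys zs))) :=
    (tendsto_finsetSum _ fun i _ => tendsto_fval hS h1 h2 hgen hx hx' hy' hz' hF i).add
      ((tendsto_smoothLag h2 hx hy hz).add htail)
  have := tendsto_nhds_unique (hℓ.comp hψ.tendsto_atTop) hsub
  rw [this] at hℓ
  exact ⟨hℓ, hstep⟩

end LimitPoint

end Data

/-! ### The Kurdyka–Łojasiewicz inequality along the iterates -/

theorem continuous_lyapPoint {p : ℕ} {n : Fin p → ℕ} {q m : ℕ} :
    Continuous fun t : ((∀ i, Vec (n i)) × Vec q × Vec m) × ((∀ i, Vec (n i)) × Vec q × Vec m) =>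
      lyapPoint t.1.1 t.1.2.1 t.1.2.2 t.2.2.1 t.2.2.2 := by
  unfold lyapPoint
  fun_prop

theorem HasKLExponent.rpow_le {E : Type*} [NormedAddCommGroup E] [InnerProductSpace ℝ E]
    {Φ : E → EReal} {a : E} {θ c : ℝ} (h : HasKLExponent Φ a θ c) {φa : ℝ} (ha : Φ a = φa) :
    ∃ U ∈ 𝓝 a, ∃ η : ℝ, 0 < η ∧ ∀ v ∈ U, ∀ φv : ℝ, Φ v = φv → 0 < φv - φa → φv - φa < η →
      ∀ s ∈ limSubdiff Φ v, (φv - φa) ^ θ ≤ c * ‖s‖ := by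
  obtain ⟨-, -, hc, -, U, hU, η, hη, hkl⟩ := h
  refine ⟨U, hU, η, hη, fun v hv φv hφv h0 h1 s hs => ?_⟩
  have hle := hkl v hv (by rw [ha, hφv]; exact_mod_cast sub_pos.1 h0)
    (by rw [ha, hφv, ← EReal.coe_add, EReal.coe_lt_coe_iff]; linarith)
  rw [hφv, ha, EReal.toReal_coe, EReal.toReal_coe] at hle
  have hdist : Metric.infEDist 0 (limSubdiff Φ v) ≤ ENNReal.ofReal ‖s‖ := by
    refine (Metric.infEDist_le_edist_of_mem hs).trans (le_of_eq ?_)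
    rw [edist_dist, dist_zero_left]
  have h2 := hle.trans (mul_le_mul_right hdist _)
  rw [← ENNReal.ofReal_mul hc.le] at h2
  exact (ENNReal.ofReal_le_ofReal_iff (by positivity)).1 h2

namespace Data

variable {p : ℕ} {n : Fin p → ℕ} {q m : ℕ} {S : Data p n q m}
  {x : ℕ → ∀ i, Vec (n i)} {y : ℕ → Vec q} {z : ℕ → Vec m} {τ : Fin p → ℝ}

theorem f_ne_top_of_Lbar_ne_top (hS : S.Standing) {x : ∀ i, Vec (n i)} {y y' : Vec q}
    {z z' : Vec m} (h : S.Lbar (lyapPoint x y z y' z') ≠ ⊤) (i : Fin p) : S.f i (x i) ≠ ⊤ := by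
  intro htop
  apply h
  rw [Lbar_lyapPoint, ← Finset.add_sum_erase _ _ (Finset.mem_univ i), htop,
    EReal.top_add_of_ne_bot (ereal_sum_ne_bot _ fun j _ => (hS.proper j).1 _), EReal.top_add_coe]

theorem dist_iterate_le_sqrt_stepSq (x : ℕ → ∀ i, Vec (n i)) (y : ℕ → Vec q) (z : ℕ → Vec m)
    (k : ℕ) : dist (x (k + 1), y (k + 1), z (k + 1)) (x k, y k, z k)
      ≤ √(stepSq x y z (k + 1)) := by
  have h0 : 0 ≤ ∑ i, ‖x (k + 1) i - x k i‖ ^ 2 := Finset.sum_nonneg fun i _ => by positivity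
  have hst : stepSq x y z (k + 1) = ∑ i, ‖x (k + 1) i - x k i‖ ^ 2 + ‖y (k + 1) - y k‖ ^ 2
    + ‖z (k + 1) - z k‖ ^ 2 := rfl
  have hy := sq_nonneg ‖y (k + 1) - y k‖
  have hz := sq_nonneg ‖z (k + 1) - z k‖
  rw [Prod.dist_eq, Prod.dist_eq]
  refine max_le ((dist_pi_le_iff (Real.sqrt_nonneg _)).2 fun i => ?_) (max_le ?_ ?_) <;>
    rw [dist_eq_norm] <;> refine Real.le_sqrt_of_sq_le ?_
  · have := norm_x_step_sq_le x (k + 1) i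
    rw [Nat.add_sub_cancel] at this
    linarith
  · linarith
  · linarith

theorem alphaBar_pos (hS : S.Standing) (hσ : 0 < S.sigma τ) {c : ℝ} (hc : 0 < c) :
    0 < S.alphaBar τ c := by
  have := rhoTilde_pos hS
  unfold alphaBar
  positivity

/-- Near a Kurdyka–Łojasiewicz limit point the gaps of the Lyapunov values eventually satisfy the
recursive inequality that determines their rate of convergence. -/
theorem exists_forall_ge_gap_recursion (hp : 1 ≤ p) (hS : S.Standing) (h2 : S.A2) (h3 : S.A3)
    (h4 : S.A4 τ) (hσ : 0 < S.sigma τ) (hgen : S.IsGenerated x y z) {xs : ∀ i, Vec (n i)}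
    {ys : Vec q} {zs : Vec m} {ψ : ℕ → ℕ} (hψ : StrictMono ψ)
    (hx : Tendsto (fun j => x (ψ j)) atTop (𝓝 xs))
    (hy : Tendsto (fun j => y (ψ j)) atTop (𝓝 ys))
    (hz : Tendsto (fun j => z (ψ j)) atTop (𝓝 zs)) {θ c : ℝ}
    (hKL : HasKLExponent S.Lbar (lyapPoint xs ys zs ys zs) θ c) {ℓ : ℝ}
    (hℓ : S.Lbar (lyapPoint xs ys zs ys zs) = ℓ) {e : ℕ → ℝ}
    (he : ∀ k, e (k + 1) = S.lyapVal x y z (k + 1) - ℓ)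
    (hlim : Tendsto e atTop (𝓝 0)) (hstep : Tendsto (stepSq x y z) atTop (𝓝 0)) :
    ∃ K, 1 ≤ K ∧ ∀ k ≥ K, 0 < e (k + 1) →
      S.alphaBar τ c * e (k + 1) ^ (2 * θ) ≤ e k - e (k + 1) := by
  have hθ0 := hKL.1
  have hθ1 := hKL.2.1
  have hc := hKL.2.2.1
  have hρ := rhoTilde_pos hS
  have hdec : ∀ k, 1 ≤ k → S.sigma τ / 2 * √(stepSq x y z (k + 1)) ^ 2 ≤ e k - e (k + 1) := by
    intro k hk
    obtain ⟨k, rfl⟩ := Nat.exists_eq_add_of_le' hk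
    rw [Real.sq_sqrt (stepSq_nonneg x y z _), he, he]
    have := lyapVal_decrease hS h2 h3 h4 hgen hσ k
    linarith
  -- If some gap is not positive, monotonicity keeps all later gaps nonpositive and the recursion is
  -- vacuous.
  by_cases hpos : ∀ k, 1 ≤ k → 0 < e k
  · set C := c * (S.rhoTilde * √((p : ℝ) + 2)) with hC
    have hC0 : 0 < C := by positivity
    obtain ⟨U, hU, η, hη, hkl⟩ := hKL.rpow_le hℓ
    have hnhds := (continuous_lyapPoint (n := n)).tendsto ((xs, ys, zs), (xs, ys, zs)) hU
    obtain ⟨r, hr, hball⟩ := Metric.mem_nhds_iff.1 hnhds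
    have hsqrt : Tendsto (fun k => √(stepSq x y z k)) atTop (𝓝 0) := by
      have := hstep.sqrt
      rwa [Real.sqrt_zero] at this
    obtain ⟨K, hK1, hK⟩ := exists_forall_ge_kl (w := fun k => (x k, y k, z k))
      (d := fun k => √(stepSq x y z k)) (half_pos hσ) hC0 hr hη hθ0 hθ1
      (fun k => Real.sqrt_nonneg _) (dist_iterate_le_sqrt_stepSq x y z) hdec hpos hlim hsqrt hψ
      (hx.prodMk_nhds (hy.prodMk_nhds hz)) (by
        intro k hk hd1 hd2 hek
        have hek0 := hpos k hk
        obtain ⟨k, rfl⟩ := Nat.exists_eq_add_of_le' hk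
        obtain ⟨s, hs, hsle⟩ := exists_subgradient_le_stepSq hp hS h2 hgen k
        have hmem : ((x (k + 1), y (k + 1), z (k + 1)), (x k, y k, z k))
            ∈ Metric.ball ((xs, ys, zs), (xs, ys, zs)) r := by
          rw [Metric.mem_ball, Prod.dist_eq]
          exact max_lt hd1 hd2
        rw [he] at hek0 hek ⊢
        have := hkl _ (hball hmem) _ (LbarSeq_succ hS hgen k) hek0 hek s hs
        refine this.trans ?_
        rw [hC, mul_assoc, mul_assoc]
        exact mul_le_mul_of_nonneg_left hsle hc.le)
    refine ⟨K, hK1, fun k hk hk0 => ?_⟩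
    have a1 := hK (k + 1) (by omega)
    have a2 := hdec k (by omega)
    have a3 := pow_le_pow_left₀ (Real.rpow_nonneg hk0.le θ) a1 2
    have a4 : e (k + 1) ^ (2 * θ) = (e (k + 1) ^ θ) ^ 2 := by
      rw [mul_comm, Real.rpow_mul hk0.le, Real.rpow_two]
    -- The constant `ᾱ` is the decrease constant `σ / 2` divided by the square of the constant in
    -- `e^θ ≤ C d`.
    have a5 : S.alphaBar τ c * C ^ 2 = S.sigma τ / 2 := by
      rw [hC, alphaBar, mul_pow, mul_pow, Real.sq_sqrt (by positivity)]
      field_simp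
    rw [a4]
    have a6 := mul_le_mul_of_nonneg_left a3 (alphaBar_pos hS hσ hc).le
    rw [mul_pow, ← mul_assoc, a5] at a6
    exact a6.trans a2
  · push Not at hpos
    obtain ⟨K, hK1, hK⟩ := hpos
    have hzero : ∀ j, e (K + j) ≤ 0 := by
      intro j
      induction j with
      | zero => exact hK
      | succ j ih =>
        have h1 := hdec (K + j) (by omega)
        have h2 : 0 ≤ S.sigma τ / 2 * √(stepSq x y z (K + j + 1)) ^ 2 := by positivity
        rw [← add_assoc]
        linarith
    refine ⟨K, hK1, fun k hk hk0 => ?_⟩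
    have := hzero (k + 1 - K)
    rw [show K + (k + 1 - K) = k + 1 by omega] at this
    linarith

end Data

end PADMM

theorem theorem2 {p : ℕ} {n : Fin p → ℕ} {q m : ℕ} (hp : 1 ≤ p)
    (S : PADMM.Data p n q m) (hS : S.Standing)
    (τ : Fin p → ℝ) (h1 : S.A1) (h2 : S.A2) (h3 : S.A3) (h4 : S.A4 τ)
    (hσ : 0 < S.sigma τ)
    (x : ℕ → ∀ i, PADMM.Vec (n i)) (y : ℕ → PADMM.Vec q) (z : ℕ → PADMM.Vec m)
    (hgen : S.IsGenerated x y z)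
    (xs : ∀ i, PADMM.Vec (n i)) (ys : PADMM.Vec q) (zs : PADMM.Vec m)
    (hlim : PADMM.IsLimitPoint x y z xs ys zs)
    (θ c : ℝ)
    (hKL : PADMM.HasKLExponent S.Lbar (PADMM.lyapPoint xs ys zs ys zs) θ c)
    (e : ℕ → ℝ) (he : e = S.gap x y z (PADMM.lyapPoint xs ys zs ys zs)) :
    (∀ k : ℕ, 1 ≤ k → S.LbarSeq x y z k ≠ ⊤ ∧ 0 ≤ e k) ∧
    Tendsto e atTop (𝓝 0) ∧
    (θ = 0 → ∃ K : ℕ, ∀ k : ℕ, K ≤ k → e k = 0) ∧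
    (0 < θ → θ ≤ 1 / 2 →
      ∃ K : ℕ, 1 ≤ K ∧ ∀ k₀ : ℕ, K ≤ k₀ → ∀ k : ℕ, k₀ ≤ k →
        e k ≤ e k₀ / (1 + S.alphaBar τ c * e k₀ ^ (2 * θ - 1)) ^ (k - k₀)) ∧
    (1 / 2 < θ → θ < 1 →
      ∃ μ : ℝ, 0 < μ ∧ ∃ K : ℕ, 2 ≤ K ∧ ∀ k₀ : ℕ, K ≤ k₀ → ∀ k : ℕ, k₀ ≤ k →
        e k ≤ (μ * ((k : ℝ) - (k₀ : ℝ)) + μ + e (k₀ - 1) ^ (1 - 2 * θ)) ^ (1 / (1 - 2 * θ))) := by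
  obtain ⟨φ, hφ, hx, hy, hz⟩ := hlim
  obtain ⟨s, hs⟩ := hKL.2.2.2.1
  have hF : ∀ i, S.f i (xs i) = (S.f i (xs i)).toReal := fun i =>
    (EReal.coe_toReal (PADMM.Data.f_ne_top_of_Lbar_ne_top hS hs.1 i) ((hS.proper i).1 _)).symm
  -- Dropping the first term makes all indices of the subsequence successors, at which the `fᵢ` are
  -- known to be finite and a preceding iterate exists.
  obtain ⟨ψ, hψ⟩ : ∃ ψ : ℕ → ℕ, ∀ j, φ (j + 1) = ψ j + 1 :=
    ⟨fun j => φ (j + 1) - 1, fun j =>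
      (Nat.sub_add_cancel ((Nat.le_add_left 1 j).trans (hφ.id_le (j + 1)))).symm⟩
  have hψm : StrictMono ψ := fun i j hij => by
    have := hφ (Nat.add_lt_add_right hij 1)
    rw [hψ, hψ] at this
    omega
  have hshift := tendsto_add_atTop_nat 1
  have hx' : Tendsto (fun j => x (ψ j + 1)) atTop (𝓝 xs) := by
    simpa only [Function.comp_def, hψ] using hx.comp hshift
  have hy' : Tendsto (fun j => y (ψ j + 1)) atTop (𝓝 ys) := by
    simpa only [Function.comp_def, hψ] using hy.comp hshift
  have hz' : Tendsto (fun j => z (ψ j + 1)) atTop (𝓝 zs) := by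
    simpa only [Function.comp_def, hψ] using hz.comp hshift
  obtain ⟨hval, hstep⟩ :=
    PADMM.Data.tendsto_lyapVal hS h1 h2 h3 h4 hgen hσ hψm hx' hy' hz' hF
  have hL := S.Lbar_eq_coe hF ys zs ys zs
  set ℓ := ∑ i, (S.f i (xs i)).toReal + (S.smoothLag xs ys zs + S.lyapTail ys zs ys zs)
  have hanti := PADMM.Data.lyapVal_antitone hS h2 h3 h4 hgen hσ
  have hek : ∀ k, e (k + 1) = S.lyapVal x y z (k + 1) - ℓ := fun k => by
    rw [he, PADMM.Data.gap, PADMM.Data.LbarSeq_succ hS hgen, hL, EReal.toReal_coe,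
      EReal.toReal_coe]
  have he0 : ∀ k, 0 ≤ e (k + 1) := fun k => by
    rw [hek, sub_nonneg]
    exact hanti.le_of_tendsto hval k
  have helim : Tendsto e atTop (𝓝 0) := by
    rw [← tendsto_add_atTop_iff_nat 1]
    simp only [hek]
    simpa using hval.sub_const ℓ
  obtain ⟨K, hK1, hrec⟩ := PADMM.Data.exists_forall_ge_gap_recursion hp hS h2 h3 h4 hσ hgen hφ
    hx hy hz hKL hL hek helim hstep
  have hnn : ∀ k ≥ K, 0 ≤ e k := fun k hk => by
    obtain ⟨k, rfl⟩ := Nat.exists_eq_add_of_le' (hK1.trans hk)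
    exact he0 k
  have hmono : ∀ k ≥ K, e (k + 1) ≤ e k := fun k hk => by
    obtain ⟨k, rfl⟩ := Nat.exists_eq_add_of_le' (hK1.trans hk)
    rw [hek, hek]
    exact sub_le_sub_right (hanti (Nat.le_succ k)) ℓ
  have hγ := PADMM.Data.alphaBar_pos hS hσ hKL.2.2.1
  refine ⟨fun k hk => ?_, helim, fun hθ => ?_, fun _ hθ => ?_, fun hθ _ => ?_⟩
  · obtain ⟨k, rfl⟩ := Nat.exists_eq_add_of_le' hk
    rw [PADMM.Data.LbarSeq_succ hS hgen]
    exact ⟨EReal.coe_ne_top _, he0 k⟩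
  · refine PADMM.eventually_eq_zero_of_recursive helim hnn hγ fun k hk hpos => ?_
    simpa [hθ] using hrec k hk hpos
  · exact ⟨K, hK1, fun k₀ hk₀ k hk =>
      PADMM.linear_rate_of_recursive hnn hmono hθ hγ hrec hk₀ hk⟩
  · exact PADMM.sublinear_rate_of_recursive helim hnn hmono hθ hγ hrec
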